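/- Let $\mathcal{T}$ be the moduli space of nondegenerate ordered triangles $\triangle_{ABC}$ lying either in the hyperbolic plane or in the Euclidean plane, where hyperbolic triangles are identified when they are congruent, and Euclidean triangles when they are similar, in both cases by a correspondence that respects the order of the vertices. An element of $\mathcal{T}$ is parametrized by the ordered triple of its angles, which identifies $\mathcal{T}$ with $\{(x,y,z)\in\mathbb{R}^3 : x,y,z>0,\ x+y+z\le\pi\}$, and $\mathcal{T}$ carries the topology of a subspace of $\mathbb{R}^3$. Let $\mathcal{T}_E\subset\mathcal{T}$ be the set of classes of (nondegenerate) Euclidean triangles, i.e. $x+y+z=\pi$. For a triangle $\triangle_{ABC}$ let $A',B',C'$ be the midpoints of the edges $BC$, $CA$, $AB$. The three mid-lines $B'C'$, $C'A'$, $A'B'$ cut out four smaller triangles, and this defines maps $f_A,f_B,f_C,f_M:\mathcal{T}\to\mathcal{T}$ by $$f_A(\triangle_{ABC})=\triangle_{AC'B'},\quad f_B(\triangle_{ABC})=\triangle_{C'BA'},\quad f_C(\triangle_{ABC})=\triangle_{B'A'C},\quad f_M(\triangle_{ABC})=\triangle_{A'B'C'}.$$ **Theorem 1.** The iterated function system $\{f_A,f_B,f_C,f_M\}$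 on $\mathcal{T}$ is converging and the limit functions are continuous. That is, for every infinite sequence $s=(s_1,s_2,\dots)$ in the letters $A,B,C,M$ and every $\triangle\in\mathcal{T}$, the sequence defined by $\triangle_0=\triangle$, $\triangle_n=f_{s_n}(\triangle_{n-1})$ converges in $\mathcal{T}$ to a limit $\Phi_s(\triangle)\in\mathcal{T}_E$, a nondegenerate Euclidean triangle; and for every $s$ the limit function $\Phi_s:\mathcal{T}\to\mathcal{T}_E$ is continuous. -/

import Mathlib

open Filter Topology UpperHalfPlane
open scoped ComplexConjugate

namespace TriangleIFS

/-- The four letters of the iterated function system. -/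
inductive Letter
  | A | B | C | M

/-- The Euclidean plane. -/
abbrev Plane : Type := EuclideanSpace ℝ (Fin 2)

/-- Given a midpoint operation, the vertices of the four small triangles cut out of the triangle
with vertices `v 0 = A`, `v 1 = B`, `v 2 = C` by its three mid-lines. The vertices are ordered so
that in the Euclidean case each small triangle is similar to the given one as an ordered triangle:
the corner triangles keep their corner in its place, and the `i`-th vertex of the middle triangle
is the midpoint of the side opposite to the `i`-th vertex. -/
def subVertices {P : Type} (mid : P → P → P) (v : Fin 3 → P) : Letter → Fin 3 → P
  | .A => ![v 0, mid (v 0) (v 1), mid (v 0) (v 2)]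
  | .B => ![mid (v 0) (v 1), v 1, mid (v 1) (v 2)]
  | .C => ![mid (v 0) (v 2), mid (v 1) (v 2), v 2]
  | .M => ![mid (v 1) (v 2), mid (v 0) (v 2), mid (v 0) (v 1)]

/-! ### Hyperbolic midpoints and angles in the upper half-plane -/

/-- The hyperbolic midpoint of two points of the upper half-plane. -/
noncomputable def hypMidpoint (z w : ℍ) : ℍ :=
  ⟨⟨(z.re * w.im + w.re * z.im) / (z.im + w.im),
    √(z.im * w.im * ((z.re - w.re) ^ 2 + (z.im + w.im) ^ 2)) / (z.im + w.im)⟩, by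
    have hz := z.im_pos
    have hw := w.im_pos
    have : 0 < z.im * w.im * ((z.re - w.re) ^ 2 + (z.im + w.im) ^ 2) := by positivity
    have := Real.sqrt_pos.2 this
    show 0 < √(z.im * w.im * ((z.re - w.re) ^ 2 + (z.im + w.im) ^ 2)) / (z.im + w.im)
    positivity⟩

/-- The isometry `w ↦ (w - z) / (w - conj z)` of the upper half-plane onto the unit disc model that
sends `z` to the centre. It is conformal and sends geodesics through `z` to diameters. -/
noncomputable def cayley (z w : ℍ) : ℂ := ((w : ℂ) - z) / ((w : ℂ) - conj (z : ℂ))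

/-- The angle at `z` between the geodesic rays from `z` to `w₁` and from `z` to `w₂`: the Euclidean
angle at the centre of the disc, after `z` has been moved there. -/
noncomputable def hypAngle (w₁ z w₂ : ℍ) : ℝ :=
  InnerProductGeometry.angle (cayley z w₁) (cayley z w₂)

lemma cosh_dist_coord (z w : ℍ) :
    Real.cosh (dist z w) = ((z.re - w.re) ^ 2 + z.im ^ 2 + w.im ^ 2) / (2 * z.im * w.im) := by
  have hz := z.im_pos
  have hw := w.im_pos
  rw [UpperHalfPlane.cosh_dist, Complex.dist_eq, Complex.sq_norm, Complex.normSq_apply]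
  simp only [Complex.sub_re, Complex.sub_im, UpperHalfPlane.coe_re, UpperHalfPlane.coe_im]
  field_simp
  ring

lemma cosh_dist_hypMidpoint (z w u : ℍ) :
    Real.cosh (dist (hypMidpoint z w) u) =
      (Real.cosh (dist z u) + Real.cosh (dist w u)) / √(2 + 2 * Real.cosh (dist z w)) := by
  have hz := z.im_pos
  have hw := w.im_pos
  have hu := u.im_pos
  set N := (z.re - w.re) ^ 2 + (z.im + w.im) ^ 2 with hN
  have hNpos : 0 < N := by positivity
  have hp : 0 < z.im * w.im := by positivity
  have h1 : 2 + 2 * Real.cosh (dist z w) = N / (z.im * w.im) := by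
    rw [cosh_dist_coord]; field_simp; ring
  have hre : (hypMidpoint z w).re = (z.re * w.im + w.re * z.im) / (z.im + w.im) := rfl
  have him : (hypMidpoint z w).im = √(z.im * w.im) * √N / (z.im + w.im) := by
    rw [← Real.sqrt_mul hp.le]; rfl
  have s1 := Real.sq_sqrt hp.le
  have s2 := Real.sq_sqrt hNpos.le
  have p1 := Real.sqrt_pos.2 hp
  have p2 := Real.sqrt_pos.2 hNpos
  have key : ((hypMidpoint z w).re - u.re) ^ 2 + (hypMidpoint z w).im ^ 2 + u.im ^ 2 =
      (w.im * ((z.re - u.re) ^ 2 + z.im ^ 2 + u.im ^ 2) +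
        z.im * ((w.re - u.re) ^ 2 + w.im ^ 2 + u.im ^ 2)) / (z.im + w.im) := by
    rw [hre, him, div_pow, mul_pow, s1, s2, hN]
    field_simp
    ring
  rw [h1, Real.sqrt_div hNpos.le, cosh_dist_coord, key, cosh_dist_coord, cosh_dist_coord, him]
  set P := √(z.im * w.im)
  set Q := √N
  have e : z.im = P ^ 2 / w.im := by rw [s1]; field_simp
  field_simp
  rw [s1]
  ring

lemma two_add_two_cosh (x : ℝ) : √(2 + 2 * Real.cosh x) = 2 * Real.cosh (x / 2) := by
  have h : 2 + 2 * Real.cosh x = (2 * Real.cosh (x / 2)) ^ 2 := by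
    have h1 := Real.cosh_two_mul (x / 2)
    have h2 := Real.cosh_sq (x / 2)
    rw [mul_div_cancel₀ x (two_ne_zero)] at h1
    rw [h1]; linarith
  rw [h, Real.sqrt_sq (by positivity)]

lemma cosh_dist_injective {z w z' w' : ℍ}
    (h : Real.cosh (dist z w) = Real.cosh (dist z' w')) : dist z w = dist z' w' :=
  Real.cosh_strictMonoOn.injOn (Set.mem_Ici.2 dist_nonneg) (Set.mem_Ici.2 dist_nonneg) h

lemma hypMidpoint_comm (z w : ℍ) : hypMidpoint z w = hypMidpoint w z := by
  apply UpperHalfPlane.ext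
  apply Complex.ext
  · show (z.re * w.im + w.re * z.im) / (z.im + w.im) = (w.re * z.im + z.re * w.im) / (w.im + z.im)
    rw [add_comm, add_comm z.im]
  · show √(z.im * w.im * ((z.re - w.re) ^ 2 + (z.im + w.im) ^ 2)) / (z.im + w.im) =
      √(w.im * z.im * ((w.re - z.re) ^ 2 + (w.im + z.im) ^ 2)) / (w.im + z.im)
    rw [add_comm z.im, mul_comm z.im, sub_sq_comm]

/-- `hypMidpoint z w` is at half the distance from `z` (and, by symmetry, from `w`), so it is the
midpoint of the geodesic segment. -/
lemma dist_hypMidpoint_left (z w : ℍ) : dist (hypMidpoint z w) z = dist z w / 2 := by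
  have h := cosh_dist_hypMidpoint z w z
  have h2 := Real.cosh_two_mul (dist z w / 2)
  have h3 := Real.cosh_sq (dist z w / 2)
  have h4 := Real.cosh_pos (dist z w / 2)
  rw [mul_div_cancel₀ _ (two_ne_zero)] at h2
  rw [two_add_two_cosh, dist_self, Real.cosh_zero, dist_comm w z, h2, eq_div_iff (by positivity)]
    at h
  have h5 : Real.cosh (dist (hypMidpoint z w) z) = Real.cosh (dist z w / 2) := by
    apply mul_right_cancel₀ h4.ne'
    linarith
  exact Real.cosh_strictMonoOn.injOn (Set.mem_Ici.2 dist_nonneg)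
    (Set.mem_Ici.2 (by positivity)) h5

lemma dist_hypMidpoint_right (z w : ℍ) : dist (hypMidpoint z w) w = dist z w / 2 := by
  rw [hypMidpoint_comm, dist_hypMidpoint_left, dist_comm]

lemma dist_hypMidpoint_congr {z w u z' w' u' : ℍ} (h₁ : dist z u = dist z' u')
    (h₂ : dist w u = dist w' u') (h₃ : dist z w = dist z' w') :
    dist (hypMidpoint z w) u = dist (hypMidpoint z' w') u' := by
  apply cosh_dist_injective
  rw [cosh_dist_hypMidpoint, cosh_dist_hypMidpoint, h₁, h₂, h₃]

lemma subVertices_congruent {v v' : Fin 3 → ℍ} (h : Congruent v v') (L : Letter) :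
    Congruent (subVertices hypMidpoint v L) (subVertices hypMidpoint v' L) := by
  rw [congruent_iff_dist_eq] at h
  have hm : ∀ i j k, dist (hypMidpoint (v i) (v j)) (v k) =
      dist (hypMidpoint (v' i) (v' j)) (v' k) := fun i j k =>
    dist_hypMidpoint_congr (h _ _) (h _ _) (h _ _)
  have hm' : ∀ i j k, dist (v k) (hypMidpoint (v i) (v j)) =
      dist (v' k) (hypMidpoint (v' i) (v' j)) := fun i j k => by
    rw [dist_comm, hm, dist_comm]
  have hmm : ∀ i j k l, dist (hypMidpoint (v i) (v j)) (hypMidpoint (v k) (v l)) =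
      dist (hypMidpoint (v' i) (v' j)) (hypMidpoint (v' k) (v' l)) := fun i j k l =>
    dist_hypMidpoint_congr (hm' _ _ _) (hm' _ _ _) (h _ _)
  rw [congruent_iff_dist_eq]
  intro i j
  cases L <;> fin_cases i <;> fin_cases j <;> simp [subVertices, hm, hm', hmm]

/-! ### Nondegenerate triangles -/

/-- Three points of the hyperbolic plane are the vertices of a (nondegenerate) triangle: they do
not lie on a common geodesic, that is, none of them lies on the segment joining the two others. -/
def IsHypTriangle (v : Fin 3 → ℍ) : Prop :=
  ∀ i j k : Fin 3, i ≠ j → j ≠ k → i ≠ k →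
    dist (v i) (v k) < dist (v i) (v j) + dist (v j) (v k)

/-- The determinant of the matrix of the hyperbolic cosines of the distances. -/
noncomputable def gram (p q r : ℍ) : ℝ :=
  1 + 2 * Real.cosh (dist q r) * Real.cosh (dist p r) * Real.cosh (dist p q) -
    Real.cosh (dist q r) ^ 2 - Real.cosh (dist p r) ^ 2 - Real.cosh (dist p q) ^ 2

lemma gram_eq (p q r : ℍ) : gram p q r =
    (Real.cosh (dist q r) - Real.cosh (dist p r - dist p q)) *
      (Real.cosh (dist p r + dist p q) - Real.cosh (dist q r)) := by
  rw [Real.cosh_add, Real.cosh_sub, gram]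
  have h1 := Real.cosh_sq (dist p r)
  have h2 := Real.cosh_sq (dist p q)
  linear_combination (Real.sinh (dist p q) ^ 2) * h1 + (Real.cosh (dist p r) ^ 2 - 1) * h2

lemma isHypTriangle_iff (v : Fin 3 → ℍ) :
    IsHypTriangle v ↔ 0 < gram (v 0) (v 1) (v 2) := by
  rw [gram_eq]
  have t1 := dist_triangle (v 1) (v 0) (v 2)
  have t2 := dist_triangle (v 0) (v 1) (v 2)
  have t3 := dist_triangle (v 0) (v 2) (v 1)
  have c1 := dist_comm (v 1) (v 0)
  have c2 := dist_comm (v 2) (v 1)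
  have c3 := dist_comm (v 2) (v 0)
  constructor
  · intro h
    have h1 := h 1 0 2 (by decide) (by decide) (by decide)
    have h2 := h 0 1 2 (by decide) (by decide) (by decide)
    have h3 := h 0 2 1 (by decide) (by decide) (by decide)
    apply mul_pos
    · rw [sub_pos, Real.cosh_lt_cosh, abs_of_nonneg (dist_nonneg : 0 ≤ dist (v 1) (v 2)), abs_lt]
      constructor <;> linarith
    · rw [sub_pos, Real.cosh_lt_cosh, abs_of_nonneg (dist_nonneg : 0 ≤ dist (v 1) (v 2)),
        abs_of_nonneg (by positivity)]
      linarith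
  · intro h
    have n1 : dist (v 1) (v 2) ≠ dist (v 0) (v 2) + dist (v 0) (v 1) := by
      intro e; rw [e] at h; simp at h
    have n2 : dist (v 1) (v 2) ≠ dist (v 0) (v 2) - dist (v 0) (v 1) := by
      intro e; rw [e] at h; simp at h
    have n3 : dist (v 1) (v 2) ≠ -(dist (v 0) (v 2) - dist (v 0) (v 1)) := by
      intro e; rw [e, Real.cosh_neg] at h; simp at h
    have s1 : dist (v 1) (v 2) < dist (v 0) (v 2) + dist (v 0) (v 1) :=
      lt_of_le_of_ne (by linarith) n1
    have s2 : dist (v 0) (v 2) < dist (v 0) (v 1) + dist (v 1) (v 2) :=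
      lt_of_le_of_ne (by linarith) (fun e => n2 (by linarith))
    have s3 : dist (v 0) (v 1) < dist (v 0) (v 2) + dist (v 1) (v 2) :=
      lt_of_le_of_ne (by linarith) (fun e => n3 (by linarith))
    intro i j k hij hjk hik
    fin_cases i <;> fin_cases j <;> fin_cases k <;> simp at hij hjk hik ⊢ <;> linarith

lemma isHypTriangle_subVertices {v : Fin 3 → ℍ} (h : IsHypTriangle v) (L : Letter) :
    IsHypTriangle (subVertices hypMidpoint v L) := by
  rw [isHypTriangle_iff] at h ⊢
  have hs : ∀ z w : ℍ, 0 < √(2 + 2 * Real.cosh (dist z w)) := fun z w => by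
    have := Real.cosh_pos (dist z w)
    positivity
  have hq : ∀ z w : ℍ, √(2 + 2 * Real.cosh (dist z w)) ^ 2 = 2 + 2 * Real.cosh (dist z w) :=
    fun z w => Real.sq_sqrt (by have := Real.cosh_pos (dist z w); positivity)
  have hm' : ∀ z w u : ℍ, Real.cosh (dist u (hypMidpoint z w)) =
      (Real.cosh (dist z u) + Real.cosh (dist w u)) / √(2 + 2 * Real.cosh (dist z w)) :=
    fun z w u => by rw [dist_comm, cosh_dist_hypMidpoint]
  have c1 := dist_comm (v 1) (v 0)
  have c2 := dist_comm (v 2) (v 1)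
  have c3 := dist_comm (v 2) (v 0)
  have s1 := hs (v 0) (v 1)
  have s2 := hs (v 0) (v 2)
  have s3 := hs (v 1) (v 2)
  have q1 := hq (v 0) (v 1)
  have q2 := hq (v 0) (v 2)
  have q3 := hq (v 1) (v 2)
  have hx := Real.cosh_pos (dist (v 1) (v 2))
  have hy := Real.cosh_pos (dist (v 0) (v 2))
  have hz := Real.cosh_pos (dist (v 0) (v 1))
  simp only [gram] at h
  cases L <;>
    simp [gram, subVertices, hm', cosh_dist_hypMidpoint, c1, c2, c3] <;>
    generalize √(2 + 2 * Real.cosh (dist (v 0) (v 1))) = P at * <;>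
    generalize √(2 + 2 * Real.cosh (dist (v 0) (v 2))) = Q at * <;>
    generalize √(2 + 2 * Real.cosh (dist (v 1) (v 2))) = R at * <;>
    generalize Real.cosh (dist (v 0) (v 1)) = z at * <;>
    generalize Real.cosh (dist (v 0) (v 2)) = y at * <;>
    generalize Real.cosh (dist (v 1) (v 2)) = x at *
  all_goals
    have hP : z = P ^ 2 / 2 - 1 := by linarith
    have hQ : y = Q ^ 2 / 2 - 1 := by linarith
    have hR : x = R ^ 2 / 2 - 1 := by linarith
    rw [← sub_pos]
  · refine lt_of_lt_of_eq (div_pos h (by positivity : 0 < P ^ 2 * Q ^ 2)) ?_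
    subst hP hQ hR
    field_simp
    ring
  · refine lt_of_lt_of_eq (div_pos h (by positivity : 0 < P ^ 2 * R ^ 2)) ?_
    subst hP hQ hR
    field_simp
    ring
  · refine lt_of_lt_of_eq (div_pos h (by positivity : 0 < Q ^ 2 * R ^ 2)) ?_
    subst hP hQ hR
    field_simp
    ring
  · refine lt_of_lt_of_eq (div_pos h (by positivity : 0 < P ^ 2 * Q ^ 2 * R ^ 2 / 4)) ?_
    subst hP hQ hR
    field_simp
    ring

/-! ### The hyperbolic law of cosines -/

lemma normSq_sub_conj (z w : ℍ) :
    Complex.normSq ((w : ℂ) - conj (z : ℂ)) =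
      2 * z.im * w.im * (Real.cosh (dist z w) + 1) := by
  have hz := z.im_pos
  have hw := w.im_pos
  rw [cosh_dist_coord, Complex.normSq_apply]
  simp only [Complex.sub_re, Complex.sub_im, Complex.conj_re, Complex.conj_im,
    UpperHalfPlane.coe_re, UpperHalfPlane.coe_im]
  field_simp
  ring

lemma normSq_sub_coe (z w : ℍ) :
    Complex.normSq ((w : ℂ) - z) = 2 * z.im * w.im * (Real.cosh (dist z w) - 1) := by
  have hz := z.im_pos
  have hw := w.im_pos
  rw [cosh_dist_coord, Complex.normSq_apply]
  simp only [Complex.sub_re, Complex.sub_im, UpperHalfPlane.coe_re, UpperHalfPlane.coe_im]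
  field_simp
  ring

lemma norm_cayley (z w : ℍ) :
    ‖cayley z w‖ = Real.sinh (dist z w) / (Real.cosh (dist z w) + 1) := by
  have hz := z.im_pos
  have hw := w.im_pos
  have hc := Real.cosh_pos (dist z w)
  have hs := Real.sinh_nonneg_iff.2 (dist_nonneg : 0 ≤ dist z w)
  have hq := Real.cosh_sq (dist z w)
  rw [← sq_eq_sq₀ (norm_nonneg _) (by positivity), Complex.sq_norm, cayley, Complex.normSq_div,
    normSq_sub_conj, normSq_sub_coe]
  field_simp
  linarith

lemma sub_conj_ne_zero (z w : ℍ) : (w : ℂ) - conj (z : ℂ) ≠ 0 := by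
  have hz := z.im_pos
  have hw := w.im_pos
  have hc := Real.cosh_pos (dist z w)
  rw [← Complex.normSq_pos, normSq_sub_conj]
  positivity

lemma norm_cayley_sub_sq (z w₁ w₂ : ℍ) :
    ‖cayley z w₁ - cayley z w₂‖ ^ 2 = 2 * (Real.cosh (dist w₁ w₂) - 1) /
      ((Real.cosh (dist z w₁) + 1) * (Real.cosh (dist z w₂) + 1)) := by
  have hz := z.im_pos
  have h1 := w₁.im_pos
  have h2 := w₂.im_pos
  have hc1 := Real.cosh_pos (dist z w₁)
  have hc2 := Real.cosh_pos (dist z w₂)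
  have e : cayley z w₁ - cayley z w₂ = ((w₁ : ℂ) - w₂) * ((z : ℂ) - conj (z : ℂ)) /
      (((w₁ : ℂ) - conj (z : ℂ)) * ((w₂ : ℂ) - conj (z : ℂ))) := by
    have n1 := sub_conj_ne_zero z w₁
    have n2 := sub_conj_ne_zero z w₂
    rw [cayley, cayley]
    field_simp
    ring
  rw [e, Complex.sq_norm, Complex.normSq_div, Complex.normSq_mul, Complex.normSq_mul,
    normSq_sub_conj, normSq_sub_conj, normSq_sub_conj, normSq_sub_coe, dist_self, Real.cosh_zero,
    dist_comm w₂ w₁]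
  field_simp
  ring

/-- The hyperbolic law of cosines. -/
lemma hypAngle_eq_arccos (w₁ z w₂ : ℍ) : hypAngle w₁ z w₂ = Real.arccos
    ((Real.cosh (dist z w₁) * Real.cosh (dist z w₂) - Real.cosh (dist w₁ w₂)) /
      (Real.sinh (dist z w₁) * Real.sinh (dist z w₂))) := by
  have hc1 := Real.cosh_pos (dist z w₁)
  have hc2 := Real.cosh_pos (dist z w₂)
  have q1 := Real.cosh_sq (dist z w₁)
  have q2 := Real.cosh_sq (dist z w₂)
  have hin : inner ℝ (cayley z w₁) (cayley z w₂) =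
      (Real.cosh (dist z w₁) * Real.cosh (dist z w₂) - Real.cosh (dist w₁ w₂)) /
        ((Real.cosh (dist z w₁) + 1) * (Real.cosh (dist z w₂) + 1)) := by
    rw [real_inner_eq_norm_mul_self_add_norm_mul_self_sub_norm_sub_mul_self_div_two,
      ← pow_two, ← pow_two, ← pow_two, norm_cayley_sub_sq, norm_cayley, norm_cayley, div_pow,
      div_pow, eq_sub_of_add_eq q1.symm, eq_sub_of_add_eq q2.symm]
    field_simp
    ring
  rw [hypAngle, InnerProductGeometry.angle, hin, norm_cayley, norm_cayley, div_mul_div_comm,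
    div_div_div_cancel_right₀ (by positivity)]

/-! ### The moduli space of hyperbolic and Euclidean triangles -/

/-- An (ordered, nondegenerate) triangle: a triple of vertices either in the hyperbolic plane or in
the Euclidean plane, not on a common line. -/
inductive Triangle
  | hyp (v : Fin 3 → ℍ) (hv : IsHypTriangle v)
  | euc (v : Fin 3 → Plane) (hv : AffineIndependent ℝ v)

namespace Triangle

/-- Ordered similarity: hyperbolic triangles are similar when they are congruent, Euclidean ones
when they are similar in the usual sense, in both cases with corresponding vertices. -/
def Rel : Triangle → Triangle → Prop
  | hyp v _, hyp v' _ => Congruent v v'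
  | euc v _, euc v' _ => Similar v v'
  | _, _ => False

instance setoid : Setoid Triangle where
  r := Rel
  iseqv :=
    { refl := by
        rintro (⟨v, hv⟩ | ⟨v, hv⟩)
        · exact Congruent.refl v
        · exact Similar.refl v
      symm := by
        rintro (⟨v, hv⟩ | ⟨v, hv⟩) (⟨w, hw⟩ | ⟨w, hw⟩) h
        · exact Congruent.symm h
        · exact h
        · exact h
        · exact Similar.symm h
      trans := by
        rintro (⟨v, hv⟩ | ⟨v, hv⟩) (⟨w, hw⟩ | ⟨w, hw⟩) (⟨u, hu⟩ | ⟨u, hu⟩) h h'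
        · exact Congruent.trans h h'
        · exact h'
        · exact h.elim
        · exact h
        · exact h
        · exact h.elim
        · exact h'
        · exact Similar.trans h h' }

/-- The triple of angles of a triangle, the `i`-th one at the `i`-th vertex. -/
noncomputable def angles : Triangle → Fin 3 → ℝ
  | hyp v _ => fun i => hypAngle (v (i + 1)) (v i) (v (i + 2))
  | euc v _ => fun i => EuclideanGeometry.angle (v (i + 1)) (v i) (v (i + 2))

end Triangle

lemma subVertices_midpoint_eq (v : Fin 3 → Plane) (L : Letter) :
    ∃ (c : Plane) (r : ℝ), |r| = 1 / 2 ∧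
      ∀ i, subVertices (midpoint ℝ) v L i = r • v i + c := by
  have hm : ∀ x y : Plane, midpoint ℝ x y = (1 / 2 : ℝ) • x + (1 / 2 : ℝ) • y := fun x y => by
    rw [midpoint_eq_smul_add, smul_add, invOf_eq_inv, one_div]
  cases L
  · refine ⟨(1 / 2 : ℝ) • v 0, 1 / 2, by norm_num, fun i => ?_⟩
    fin_cases i <;> simp only [subVertices, hm] <;> simp <;> module
  · refine ⟨(1 / 2 : ℝ) • v 1, 1 / 2, by norm_num, fun i => ?_⟩
    fin_cases i <;> simp only [subVertices, hm] <;> simp <;> module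
  · refine ⟨(1 / 2 : ℝ) • v 2, 1 / 2, by norm_num, fun i => ?_⟩
    fin_cases i <;> simp only [subVertices, hm] <;> simp <;> module
  · refine ⟨(1 / 2 : ℝ) • (v 0 + v 1 + v 2), -(1 / 2), by norm_num, fun i => ?_⟩
    fin_cases i <;> simp only [subVertices, hm] <;> simp <;> module

lemma subVertices_similar (v : Fin 3 → Plane) (L : Letter) :
    Similar (subVertices (midpoint ℝ) v L) v := by
  obtain ⟨c, r, hr, h⟩ := subVertices_midpoint_eq v L
  rw [similar_iff_exists_pos_dist_eq]
  refine ⟨1 / 2, by norm_num, fun i j => ?_⟩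
  rw [h, h, dist_add_right, dist_smul₀, Real.norm_eq_abs, hr]

lemma affineIndependent_subVertices {v : Fin 3 → Plane} (hv : AffineIndependent ℝ v)
    (L : Letter) : AffineIndependent ℝ (subVertices (midpoint ℝ) v L) := by
  obtain ⟨c, r, hr, h⟩ := subVertices_midpoint_eq v L
  have hr0 : r ≠ 0 := by
    rintro rfl
    norm_num at hr
  let f : Plane →ᵃ[ℝ] Plane := (r • LinearMap.id : Plane →ₗ[ℝ] Plane).toAffineMap +
    AffineMap.const ℝ Plane c
  have hf : ∀ x, f x = r • x + c := fun x => rfl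
  have hfi : Function.Injective f := fun x y hxy => by
    rw [hf, hf] at hxy
    exact smul_right_injective _ hr0 (add_right_cancel hxy)
  have e : subVertices (midpoint ℝ) v L = f ∘ v := by
    funext i
    rw [h, Function.comp_apply, hf]
  rw [e]
  exact hv.map' f hfi

lemma angles_congr {s t : Triangle} (h : s ≈ t) : s.angles = t.angles := by
  rcases s with ⟨v, hv⟩ | ⟨v, hv⟩ <;> rcases t with ⟨w, hw⟩ | ⟨w, hw⟩
  · have h' : Congruent v w := h
    rw [congruent_iff_dist_eq] at h'
    funext i
    simp only [Triangle.angles, hypAngle_eq_arccos, h']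
  · exact False.elim h
  · exact False.elim h
  · have h' : Similar v w := h
    funext i
    apply Similar.angle_eq
    have := h'.index_map ![i + 1, i, i + 2]
    have e : ∀ u : Fin 3 → Plane, u ∘ ![i + 1, i, i + 2] = ![u (i + 1), u i, u (i + 2)] :=
      fun u => by funext k; fin_cases k <;> rfl
    rwa [e, e] at this

/-- The small triangle of index `L` cut out of a triangle by its mid-lines. -/
noncomputable def Triangle.sub (L : Letter) : Triangle → Triangle
  | .hyp v hv => .hyp (subVertices hypMidpoint v L) (isHypTriangle_subVertices hv L)
  | .euc v hv => .euc (subVertices (midpoint ℝ) v L) (affineIndependent_subVertices hv L)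

lemma sub_congr (L : Letter) (s t : Triangle) (h : s ≈ t) : s.sub L ≈ t.sub L := by
  rcases s with ⟨v, hv⟩ | ⟨v, hv⟩ <;> rcases t with ⟨w, hw⟩ | ⟨w, hw⟩
  · exact subVertices_congruent h L
  · exact False.elim h
  · exact False.elim h
  · exact (subVertices_similar v L).trans (Similar.trans h (subVertices_similar w L).symm)

/-- The moduli space `𝒯` of hyperbolic or Euclidean triangles modulo ordered similarity. -/
def Moduli : Type := Quotient Triangle.setoid

namespace Moduli

/-- The angle coordinates, which parametrize the moduli space by the set of all
`(x, y, z) ∈ ℝ³` with `x, y, z > 0` and `x + y + z ≤ π`. -/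
noncomputable def angles : Moduli → Fin 3 → ℝ :=
  Quotient.lift Triangle.angles fun _ _ => angles_congr

/-- The topology as a subspace of `ℝ³` through the angle coordinates. -/
noncomputable instance : TopologicalSpace Moduli := TopologicalSpace.induced angles inferInstance

/-- The subspace `𝒯_E` of similarity classes of Euclidean triangles. -/
def euclidean : Set Moduli := {Δ | ∃ v hv, Δ = Quotient.mk _ (Triangle.euc v hv)}

/-- The maps `f_A`, `f_B`, `f_C`, `f_M` of the moduli space to itself. -/
noncomputable def f (L : Letter) : Moduli → Moduli :=
  Quotient.map (Triangle.sub L) (sub_congr L)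

/-- The sequence of triangles `Δ₀ = Δ`, `Δₙ₊₁ = f_{sₙ} (Δₙ)` defined by a sequence of letters. -/
noncomputable def orbit (s : ℕ → Letter) (Δ : Moduli) : ℕ → Moduli
  | 0 => Δ
  | n + 1 => f (s n) (orbit s Δ n)

end Moduli

end TriangleIFS

namespace TriangleIFS

/-! ### The dynamics in terms of the hyperbolic cosines of the sides -/

/-! Euclidean triangles are fixed by all four maps, so the dynamics is hyperbolic and can be
followed through the numbers `c i`, the hyperbolic cosines of the sides. Up to a bounded factor `c i
- 1` is the squared side of a small triangle, and at small scale subdivision divides it by nearly 4.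
Curvature only makes it shrink faster: one step divides it by a factor between 4 and `4 * halfProd
c` (`sideStep_sub_one_le`, `le_sideStep_sub_one`). The sizes decay geometrically, so the excess
factors have a convergent product. Hence `4 ^ n * (c i - 1)` decreases to a positive limit, with
explicit error bounds.

Nondegeneracy survives because the Gram determinant is divided by at most `16 * halfProd c ^ 2` per
step (`le_sideGram_sideStep`). Thus `16 ^ n` times it stays bounded below, while it tends to Heron's
form of the limits. These limits are therefore the squared sides of a genuine Euclidean triangle,
and the angles converge to its angles by the law of cosines.

The errors are locally uniform, which gives continuity at hyperbolic triangles. At a Euclidean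
triangle all sides degenerate; there one writes `c i - 1 = scale * shape i` as functions of the
angles, where `scale` vanishes exactly at the Euclidean boundary and `shape` stays positive.
Dividing the limits by `scale` leaves the angles unchanged, and the quotients are squeezed between
`shape i * exp (-size / 3)` and `shape i`, which agree on the boundary. -/

/-- The hyperbolic cosine of half the `i`-th side, if `c i` is that of the `i`-th side. -/
noncomputable def halfSide (c : Fin 3 → ℝ) (i : Fin 3) : ℝ := √((1 + c i) / 2)

/-- The hyperbolic cosine of the mid-line facing the `i`-th side. -/
noncomputable def midSide (c : Fin 3 → ℝ) (i : Fin 3) : ℝ :=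
  (1 + c 0 + c 1 + c 2) / (4 * halfSide c (i + 1) * halfSide c (i + 2))

/-- The hyperbolic cosines of the sides of the four small triangles. -/
noncomputable def sideStep : Letter → (Fin 3 → ℝ) → Fin 3 → ℝ
  | .A, c => ![midSide c 0, halfSide c 1, halfSide c 2]
  | .B, c => ![halfSide c 0, midSide c 1, halfSide c 2]
  | .C, c => ![halfSide c 0, halfSide c 1, midSide c 2]
  | .M, c => midSide c

/-- The Gram determinant of a triangle in terms of the hyperbolic cosines of its sides. -/
def sideGram (c : Fin 3 → ℝ) : ℝ :=
  1 + 2 * c 0 * c 1 * c 2 - c 0 ^ 2 - c 1 ^ 2 - c 2 ^ 2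

/-- The product of the hyperbolic cosines of the half sides. -/
noncomputable def halfProd (c : Fin 3 → ℝ) : ℝ := halfSide c 0 * halfSide c 1 * halfSide c 2

/-- The size of a triangle. -/
def size (c : Fin 3 → ℝ) : ℝ := (c 0 - 1) + (c 1 - 1) + (c 2 - 1)

/-- The conditions satisfied by the hyperbolic cosines of the sides of a possibly degenerate
triangle. -/
structure IsSides (c : Fin 3 → ℝ) : Prop where
  one_le : ∀ i, 1 ≤ c i
  gram_nonneg : 0 ≤ sideGram c

/-! ### One-step estimates for the sides and the Gram determinant. -/

lemma sideStep_eq_or (L : Letter) (c : Fin 3 → ℝ) (i : Fin 3) :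
    sideStep L c i = halfSide c i ∨ sideStep L c i = midSide c i := by
  cases L <;> fin_cases i <;> simp [sideStep]

lemma one_le_halfSide {c : Fin 3 → ℝ} (hc : ∀ i, 1 ≤ c i) (i : Fin 3) : 1 ≤ halfSide c i := by
  rw [halfSide, Real.one_le_sqrt]
  linarith [hc i]

lemma side_eq_halfSide {c : Fin 3 → ℝ} (hc : ∀ i, 1 ≤ c i) (i : Fin 3) :
    c i = 2 * halfSide c i ^ 2 - 1 := by
  rw [halfSide, Real.sq_sqrt (by linarith [hc i])]
  ring

lemma midSide_eq {c : Fin 3 → ℝ} (hc : ∀ i, 1 ≤ c i) (i : Fin 3) :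
    midSide c i = (halfSide c i ^ 2 + halfSide c (i + 1) ^ 2 + halfSide c (i + 2) ^ 2 - 1) /
      (2 * halfSide c (i + 1) * halfSide c (i + 2)) := by
  have h1 := one_le_halfSide hc (i + 1)
  have h2 := one_le_halfSide hc (i + 2)
  have hs : 1 + c 0 + c 1 + c 2 =
      2 * (halfSide c i ^ 2 + halfSide c (i + 1) ^ 2 + halfSide c (i + 2) ^ 2 - 1) := by
    have h0 := side_eq_halfSide hc 0
    have h1 := side_eq_halfSide hc 1
    have h2 := side_eq_halfSide hc 2
    fin_cases i <;> simp <;> linarith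
  rw [midSide, hs]
  field_simp
  ring

lemma halfProd_eq (c : Fin 3 → ℝ) (i : Fin 3) :
    halfProd c = halfSide c i * halfSide c (i + 1) * halfSide c (i + 2) := by
  fin_cases i <;> simp [halfProd] <;> ring

/-- The Gram determinant factors in the half-side cosines, and the cofactor is positive. The
remaining factor is the Gram determinant of the half sides; its sign says that a mid-line is at most
half of the side it faces. -/
lemma IsSides.half {c : Fin 3 → ℝ} (hc : IsSides c) (i : Fin 3) :
    0 ≤ 1 + 2 * halfSide c i * halfSide c (i + 1) * halfSide c (i + 2) -
      halfSide c i ^ 2 - halfSide c (i + 1) ^ 2 - halfSide c (i + 2) ^ 2 := by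
  have h0 := one_le_halfSide hc.one_le i
  have h1 := one_le_halfSide hc.one_le (i + 1)
  have h2 := one_le_halfSide hc.one_le (i + 2)
  have hg : sideGram c =
      (1 + 2 * halfSide c i * halfSide c (i + 1) * halfSide c (i + 2) -
        halfSide c i ^ 2 - halfSide c (i + 1) ^ 2 - halfSide c (i + 2) ^ 2) *
      (4 * (halfSide c i ^ 2 + halfSide c (i + 1) ^ 2 + halfSide c (i + 2) ^ 2 +
        2 * (halfSide c i * halfSide c (i + 1) * halfSide c (i + 2)) - 1)) := by
    have e0 := side_eq_halfSide hc.one_le 0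
    have e1 := side_eq_halfSide hc.one_le 1
    have e2 := side_eq_halfSide hc.one_le 2
    rw [sideGram, e0, e1, e2]
    fin_cases i <;> simp <;> ring
  have hp : 0 < halfSide c i * halfSide c (i + 1) * halfSide c (i + 2) := by positivity
  have := hc.gram_nonneg
  rw [hg] at this
  refine nonneg_of_mul_nonneg_left this ?_
  nlinarith

/-- A new side is half of the old one or a mid-line, hence at most half. With `p` the cosine of the
half side, `c - 1 = 2 * (p - 1) * (p + 1)` and `p + 1 ≥ 2`. -/
lemma sideStep_sub_one_le {c : Fin 3 → ℝ} (hc : IsSides c) (L : Letter) (i : Fin 3) :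
    sideStep L c i - 1 ≤ (c i - 1) / 4 := by
  have h0 := one_le_halfSide hc.one_le i
  have h1 := one_le_halfSide hc.one_le (i + 1)
  have h2 := one_le_halfSide hc.one_le (i + 2)
  have hle : sideStep L c i ≤ halfSide c i := by
    rcases sideStep_eq_or L c i with h | h
    · rw [h]
    · rw [h, midSide_eq hc.one_le, div_le_iff₀ (by positivity)]
      linarith [hc.half i]
  rw [side_eq_halfSide hc.one_le i]
  nlinarith

/-- Let `p, q, r ≥ 1` be the half-side cosines. A half side has `p - 1 = (p ^ 2 - 1) / (p + 1)` with
`p + 1 ≤ 2 * p * q * r`. A mid-line cosine minus 1 is `(p ^ 2 - 1 + (q - r) ^ 2) / (2 * q * r)`,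
where the square can be dropped. -/
lemma le_sideStep_sub_one {c : Fin 3 → ℝ} (hc : ∀ i, 1 ≤ c i) (L : Letter) (i : Fin 3) :
    (c i - 1) / (4 * halfProd c) ≤ sideStep L c i - 1 := by
  have h0 := one_le_halfSide hc i
  have h1 := one_le_halfSide hc (i + 1)
  have h2 := one_le_halfSide hc (i + 2)
  have hm : (c i - 1) / (4 * halfProd c) = (halfSide c i ^ 2 - 1) /
      (2 * (halfSide c i * halfSide c (i + 1) * halfSide c (i + 2))) := by
    rw [side_eq_halfSide hc i, halfProd_eq c i, div_eq_div_iff (by positivity) (by positivity)]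
    ring
  rw [hm]
  rcases sideStep_eq_or L c i with h | h
  · rw [h, div_le_iff₀ (by positivity)]
    have h3 : 1 ≤ halfSide c (i + 1) * halfSide c (i + 2) := one_le_mul_of_one_le_of_one_le h1 h2
    have h4 : halfSide c i ≤ halfSide c i * (halfSide c (i + 1) * halfSide c (i + 2)) :=
      le_mul_of_one_le_right (by positivity) h3
    nlinarith [mul_nonneg (sub_nonneg.2 h0) (sub_nonneg.2 h4)]
  · have e : midSide c i - 1 = (halfSide c i ^ 2 - 1 +
        (halfSide c (i + 1) - halfSide c (i + 2)) ^ 2) /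
        (2 * (halfSide c (i + 1) * halfSide c (i + 2))) := by
      rw [midSide_eq hc]
      field_simp
      ring
    rw [h, e]
    have h3 : 0 ≤ halfSide c i ^ 2 - 1 := by nlinarith
    have h4 : 0 < halfSide c (i + 1) * halfSide c (i + 2) := by positivity
    gcongr
    · nlinarith [sq_nonneg (halfSide c (i + 1) - halfSide c (i + 2))]
    · nlinarith

lemma one_le_halfProd {c : Fin 3 → ℝ} (hc : ∀ i, 1 ≤ c i) : 1 ≤ halfProd c :=
  one_le_mul_of_one_le_of_one_le (one_le_mul_of_one_le_of_one_le (one_le_halfSide hc 0)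
    (one_le_halfSide hc 1)) (one_le_halfSide hc 2)

/-- The determinant is divided exactly by 16 times the squared product of two half-side cosines
(corner triangles) or of all three (middle triangle). The 16 is the Euclidean scaling factor of a
quantity of order four in the sides. -/
lemma le_sideGram_sideStep {c : Fin 3 → ℝ} (hc : IsSides c) (L : Letter) :
    sideGram c / (16 * halfProd c ^ 2) ≤ sideGram (sideStep L c) := by
  have h0 := one_le_halfSide hc.one_le 0
  have h1 := one_le_halfSide hc.one_le 1
  have h2 := one_le_halfSide hc.one_le 2
  have key : ∃ d, 0 < d ∧ d ≤ 16 * halfProd c ^ 2 ∧ sideGram (sideStep L c) = sideGram c / d := by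
    have e0 := side_eq_halfSide hc.one_le 0
    have e1 := side_eq_halfSide hc.one_le 1
    have e2 := side_eq_halfSide hc.one_le 2
    have m0 := midSide_eq hc.one_le 0
    have m1 := midSide_eq hc.one_le 1
    have m2 := midSide_eq hc.one_le 2
    simp only [zero_add, show (1 : Fin 3) + 1 = 2 from rfl, show (1 : Fin 3) + 2 = 0 from rfl,
      show (2 : Fin 3) + 1 = 0 from rfl, show (2 : Fin 3) + 2 = 1 from rfl] at m0 m1 m2
    rw [sideGram, sideGram, e0, e1, e2, halfProd]
    generalize hp : halfSide c 0 = p at *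
    generalize hq : halfSide c 1 = q at *
    generalize hr : halfSide c 2 = r at *
    have p2 : 1 ≤ p ^ 2 := by nlinarith
    have q2 : 1 ≤ q ^ 2 := by nlinarith
    have r2 : 1 ≤ r ^ 2 := by nlinarith
    have hpos : 0 < p * q * r := by positivity
    cases L
    · refine ⟨16 * (q * r) ^ 2, by positivity, ?_, ?_⟩
      · have : (p * q * r) ^ 2 = p ^ 2 * (q * r) ^ 2 := by ring
        rw [this]; nlinarith [sq_nonneg (q * r)]
      · simp [sideStep, m0, hq, hr]; field_simp; ring
    · refine ⟨16 * (p * r) ^ 2, by positivity, ?_, ?_⟩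
      · have : (p * q * r) ^ 2 = q ^ 2 * (p * r) ^ 2 := by ring
        rw [this]; nlinarith [sq_nonneg (p * r)]
      · simp [sideStep, m1, hp, hr]; field_simp; ring
    · refine ⟨16 * (p * q) ^ 2, by positivity, ?_, ?_⟩
      · have : (p * q * r) ^ 2 = r ^ 2 * (p * q) ^ 2 := by ring
        rw [this]; nlinarith [sq_nonneg (p * q)]
      · simp [sideStep, m2, hp, hq]; field_simp; ring
    · refine ⟨16 * (p * q * r) ^ 2, by positivity, le_rfl, ?_⟩
      simp [sideStep, m0, m1, m2]; field_simp; ring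
  obtain ⟨d, hd, hle, e⟩ := key
  rw [e]
  exact div_le_div_of_nonneg_left hc.gram_nonneg hd hle

/-- Each factor is `√(1 + x / 2) ≤ exp (x / 4)` with `x = c i - 1`. Products of `halfProd` along an
orbit are thus controlled by sums of sizes. -/
lemma halfProd_le_exp {c : Fin 3 → ℝ} (hc : ∀ i, 1 ≤ c i) :
    halfProd c ≤ Real.exp (size c / 4) := by
  have h : ∀ i, halfSide c i ≤ Real.exp ((c i - 1) / 4) := fun i => by
    rw [halfSide, Real.sqrt_le_left (Real.exp_pos _).le, ← Real.exp_nat_mul]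
    refine le_trans (le_of_eq ?_) (Real.add_one_le_exp _)
    push_cast
    ring
  have e : Real.exp (size c / 4) = Real.exp ((c 0 - 1) / 4) * Real.exp ((c 1 - 1) / 4) *
      Real.exp ((c 2 - 1) / 4) := by
    rw [← Real.exp_add, ← Real.exp_add, size]; ring_nf
  rw [e, halfProd]
  have h0 := one_le_halfSide hc 0
  have h1 := one_le_halfSide hc 1
  have h2 := one_le_halfSide hc 2
  gcongr <;> apply h

lemma IsSides.sideStep {c : Fin 3 → ℝ} (hc : IsSides c) (L : Letter) :
    IsSides (sideStep L c) where
  one_le i := by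
    have h := le_sideStep_sub_one hc.one_le L i
    have h1 := one_le_halfProd hc.one_le
    have h2 : 0 ≤ (c i - 1) / (4 * halfProd c) :=
      div_nonneg (by linarith [hc.one_le i]) (by positivity)
    linarith
  gram_nonneg := (div_nonneg hc.gram_nonneg (by positivity)).trans (le_sideGram_sideStep hc L)

/-- The hyperbolic cosines of the sides along an orbit. -/
noncomputable def sideOrbit (s : ℕ → Letter) (c : Fin 3 → ℝ) : ℕ → Fin 3 → ℝ
  | 0 => c
  | n + 1 => sideStep (s n) (sideOrbit s c n)

/-- The rescaled squares of the sides along an orbit. -/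
noncomputable def scaledSide (s : ℕ → Letter) (c : Fin 3 → ℝ) (i : Fin 3) (n : ℕ) : ℝ :=
  4 ^ n * (sideOrbit s c n i - 1)

/-- The limit of the rescaled squares of the sides along an orbit. -/
noncomputable def limitSide (s : ℕ → Letter) (c : Fin 3 → ℝ) (i : Fin 3) : ℝ :=
  ⨅ n, scaledSide s c i n

/-! ### Rescaled sides along an orbit and their limits. -/

section Orbit

variable {c : Fin 3 → ℝ}

lemma IsSides.sideOrbit (hc : IsSides c) (s : ℕ → Letter) (n : ℕ) :
    IsSides (sideOrbit s c n) := by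
  induction n with
  | zero => exact hc
  | succ n ih => exact ih.sideStep _

lemma IsSides.size_nonneg (hc : IsSides c) : 0 ≤ size c := by
  have h0 := hc.one_le 0
  have h1 := hc.one_le 1
  have h2 := hc.one_le 2
  rw [size]; linarith

lemma scaledSide_nonneg (hc : IsSides c) (s : ℕ → Letter) (i : Fin 3) (n : ℕ) :
    0 ≤ scaledSide s c i n :=
  mul_nonneg (by positivity) (sub_nonneg.2 ((hc.sideOrbit s n).one_le i))

lemma scaledSide_antitone (hc : IsSides c) (s : ℕ → Letter) (i : Fin 3) :
    Antitone (scaledSide s c i) := by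
  refine antitone_nat_of_succ_le fun n => ?_
  have h := sideStep_sub_one_le (hc.sideOrbit s n) (s n) i
  have h4 : (0 : ℝ) < 4 ^ n := by positivity
  rw [scaledSide, scaledSide, sideOrbit, pow_succ]
  nlinarith

lemma size_sideOrbit_le (hc : IsSides c) (s : ℕ → Letter) (n : ℕ) :
    size (sideOrbit s c n) ≤ size c / 4 ^ n := by
  have h : ∀ i, 4 ^ n * (sideOrbit s c n i - 1) ≤ c i - 1 := fun i => by
    simpa [scaledSide, sideOrbit] using scaledSide_antitone hc s i (Nat.zero_le n)
  rw [le_div_iff₀ (by positivity), size, size]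
  linarith [h 0, h 1, h 2]

lemma halfProd_sideOrbit_le (hc : IsSides c) (s : ℕ → Letter) (n : ℕ) :
    halfProd (sideOrbit s c n) ≤ Real.exp (size c / 4 ^ (n + 1)) := by
  refine (halfProd_le_exp (hc.sideOrbit s n).one_le).trans (Real.exp_le_exp.2 ?_)
  rw [pow_succ, ← div_div]
  have := size_sideOrbit_le hc s n
  gcongr

/-- The exponent `size c / (3 * 4 ^ n)` is the tail sum of the bounds `size c / 4 ^ (k + 1)`, `k ≥
n`, for the logarithm of `halfProd`. Each step removes one term from the tail, which pays for the
possible loss by a factor `halfProd`. -/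
lemma scaledSide_mul_exp_monotone (hc : IsSides c) (s : ℕ → Letter) (i : Fin 3) :
    Monotone fun n => scaledSide s c i n * Real.exp (-(size c / (3 * 4 ^ n))) := by
  refine monotone_nat_of_le_succ fun n => ?_
  have hn := hc.sideOrbit s n
  have h := le_sideStep_sub_one hn.one_le (s n) i
  have hp := halfProd_sideOrbit_le hc s n
  have h1 := one_le_halfProd hn.one_le
  have e : Real.exp (-(size c / (3 * 4 ^ n))) =
      (Real.exp (size c / 4 ^ (n + 1)))⁻¹ * Real.exp (-(size c / (3 * 4 ^ (n + 1)))) := by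
    rw [← Real.exp_neg, ← Real.exp_add]
    congr 1
    rw [pow_succ]
    field_simp
    ring
  rw [e, ← mul_assoc]
  gcongr
  rw [← div_eq_mul_inv, div_le_iff₀ (Real.exp_pos _)]
  have h0 := scaledSide_nonneg hc s i (n + 1)
  refine le_trans ?_ (mul_le_mul_of_nonneg_left hp h0)
  rw [div_le_iff₀ (by positivity)] at h
  have h4 : (0 : ℝ) < 4 ^ n := by positivity
  rw [scaledSide, scaledSide, sideOrbit, pow_succ]
  nlinarith

/-- Same telescoping as for the sides, with doubled exponent because `halfProd` enters squared. The
lower bound does not depend on `n`, so the limit cannot degenerate. -/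
lemma le_scaledGram (hc : IsSides c) (s : ℕ → Letter) (n : ℕ) :
    sideGram c * Real.exp (-(2 * size c / 3)) ≤ 16 ^ n * sideGram (sideOrbit s c n) := by
  have hm : Monotone fun n => 16 ^ n * sideGram (sideOrbit s c n) *
      Real.exp (-(2 * size c / (3 * 4 ^ n))) := by
    refine monotone_nat_of_le_succ fun n => ?_
    have hn := hc.sideOrbit s n
    have h := le_sideGram_sideStep hn (s n)
    have hp := halfProd_sideOrbit_le hc s n
    have h1 := one_le_halfProd hn.one_le
    have e : Real.exp (-(2 * size c / (3 * 4 ^ n))) =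
        (Real.exp (size c / 4 ^ (n + 1)) ^ 2)⁻¹ *
          Real.exp (-(2 * size c / (3 * 4 ^ (n + 1)))) := by
      rw [← Real.exp_nat_mul, ← Real.exp_neg, ← Real.exp_add]
      congr 1
      rw [pow_succ]
      push_cast
      field_simp
      ring
    rw [e, ← mul_assoc]
    refine mul_le_mul_of_nonneg_right ?_ (Real.exp_pos _).le
    rw [← div_eq_mul_inv, div_le_iff₀ (by positivity)]
    have h0 : 0 ≤ (16 : ℝ) ^ (n + 1) * sideGram (sideOrbit s c (n + 1)) :=
      mul_nonneg (by positivity) (hc.sideOrbit s (n + 1)).gram_nonneg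
    refine le_trans ?_ (mul_le_mul_of_nonneg_left (pow_le_pow_left₀ (by positivity) hp 2) h0)
    rw [div_le_iff₀ (by positivity)] at h
    have h4 : (0 : ℝ) < 16 ^ n := by positivity
    rw [sideOrbit, pow_succ]
    nlinarith
  have h := hm (Nat.zero_le n)
  simp only [pow_zero, one_mul, mul_one, sideOrbit] at h
  refine h.trans (mul_le_of_le_one_right ?_ ?_)
  · exact mul_nonneg (by positivity) (hc.sideOrbit s n).gram_nonneg
  · rw [Real.exp_le_one_iff, neg_nonpos]
    have := hc.size_nonneg
    positivity

lemma bddBelow_scaledSide (hc : IsSides c) (s : ℕ → Letter) (i : Fin 3) :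
    BddBelow (Set.range (scaledSide s c i)) :=
  ⟨0, by rintro _ ⟨n, rfl⟩; exact scaledSide_nonneg hc s i n⟩

lemma tendsto_scaledSide (hc : IsSides c) (s : ℕ → Letter) (i : Fin 3) :
    Tendsto (scaledSide s c i) atTop (𝓝 (limitSide s c i)) :=
  tendsto_atTop_ciInf (scaledSide_antitone hc s i) (bddBelow_scaledSide hc s i)

lemma limitSide_le (hc : IsSides c) (s : ℕ → Letter) (i : Fin 3) (n : ℕ) :
    limitSide s c i ≤ scaledSide s c i n :=
  ciInf_le (bddBelow_scaledSide hc s i) n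

lemma le_limitSide (hc : IsSides c) (s : ℕ → Letter) (i : Fin 3) (n : ℕ) :
    scaledSide s c i n * Real.exp (-(size c / (3 * 4 ^ n))) ≤ limitSide s c i := by
  refine ge_of_tendsto (tendsto_scaledSide hc s i) ?_
  filter_upwards [eventually_ge_atTop n] with m hm
  refine (scaledSide_mul_exp_monotone hc s i hm).trans
    (mul_le_of_le_one_right (scaledSide_nonneg hc s i m) ?_)
  rw [Real.exp_le_one_iff, neg_nonpos]
  have := hc.size_nonneg
  positivity

lemma limitSide_le_sub_one (hc : IsSides c) (s : ℕ → Letter) (i : Fin 3) :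
    limitSide s c i ≤ c i - 1 := by
  simpa [scaledSide, sideOrbit] using limitSide_le hc s i 0

lemma sub_one_mul_exp_le_limitSide (hc : IsSides c) (s : ℕ → Letter) (i : Fin 3) :
    (c i - 1) * Real.exp (-(size c / 3)) ≤ limitSide s c i := by
  simpa [scaledSide, sideOrbit] using le_limitSide hc s i 0

/-- By `1 - exp (-x) ≤ x`, the two bounds on the limit are close. The error depends on `c` only
through a continuous function, which makes the convergence locally uniform. -/
lemma dist_limitSide_le (hc : IsSides c) (s : ℕ → Letter) (i : Fin 3) (n : ℕ) :
    dist (limitSide s c i) (scaledSide s c i n) ≤ (c i - 1) * size c / 4 ^ n := by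
  have h1 := limitSide_le hc s i n
  have h2 := le_limitSide hc s i n
  have h3 := Real.add_one_le_exp (-(size c / (3 * 4 ^ n)))
  have h4 := scaledSide_nonneg hc s i n
  have h5 : scaledSide s c i n ≤ c i - 1 := by
    simpa [scaledSide, sideOrbit] using scaledSide_antitone hc s i (Nat.zero_le n)
  have h6 := hc.size_nonneg
  have h7 : scaledSide s c i n * (size c / (3 * 4 ^ n)) ≤ (c i - 1) * (size c / 4 ^ n) := by
    gcongr
    · exact sub_nonneg.2 (hc.one_le i)
    · linarith [show (0 : ℝ) < 4 ^ n by positivity]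
  rw [Real.dist_eq, abs_sub_comm, abs_of_nonneg (by linarith), mul_div_assoc]
  nlinarith

/-- Expansion at the point where all cosines are 1: Heron's form plus a cubic term, which is
negligible after rescaling by `16 ^ n`. -/
lemma sideGram_eq_sub_one (c : Fin 3 → ℝ) : sideGram c =
    2 * ((c 0 - 1) * (c 1 - 1) + (c 1 - 1) * (c 2 - 1) + (c 0 - 1) * (c 2 - 1)) -
      (c 0 - 1) ^ 2 - (c 1 - 1) ^ 2 - (c 2 - 1) ^ 2 +
      2 * ((c 0 - 1) * (c 1 - 1) * (c 2 - 1)) := by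
  rw [sideGram]; ring

/-- The limit of the rescaled squares of the sides satisfies the strict triangle inequality, in
Heron's form. -/
lemma heron_limitSide_pos (hc : IsSides c) (hg : 0 < sideGram c) (s : ℕ → Letter) :
    0 < 2 * (limitSide s c 0 * limitSide s c 1 + limitSide s c 1 * limitSide s c 2 +
      limitSide s c 0 * limitSide s c 2) -
      limitSide s c 0 ^ 2 - limitSide s c 1 ^ 2 - limitSide s c 2 ^ 2 := by
  have t0 := tendsto_scaledSide hc s 0
  have t1 := tendsto_scaledSide hc s 1
  have t2 := tendsto_scaledSide hc s 2
  have t4 : Tendsto (fun n : ℕ => ((1 : ℝ) / 4) ^ n) atTop (𝓝 0) :=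
    tendsto_pow_atTop_nhds_zero_of_lt_one (by norm_num) (by norm_num)
  -- Limit of `16 ^ n` times the Gram determinant: the cubic term keeps a spare factor `4 ^ (-n)`
  -- and vanishes.
  have t := ((((((t0.mul t1).add (t1.mul t2)).add (t0.mul t2)).const_mul 2).sub
    (t0.pow 2)).sub (t1.pow 2)).sub (t2.pow 2) |>.add
    (((t0.mul t1).mul t2).const_mul 2 |>.mul t4)
  rw [mul_zero, add_zero] at t
  refine (mul_pos hg (Real.exp_pos (-(2 * size c / 3)))).trans_le (ge_of_tendsto t ?_)
  refine Eventually.of_forall fun n => (le_scaledGram hc s n).trans (le_of_eq ?_)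
  have h16 : (16 : ℝ) ^ n = 4 ^ n * 4 ^ n := by rw [← mul_pow]; norm_num
  rw [sideGram_eq_sub_one, h16, one_div_pow]
  simp only [scaledSide]
  have h4 : (4 : ℝ) ^ n ≠ 0 := by positivity
  field_simp

end Orbit

/-! ### Continuity of the limit sides. -/

lemma continuousOn_sideStep (L : Letter) :
    ContinuousOn (sideStep L) {c | ∀ i, 1 ≤ c i} := by
  have hh : ∀ i, Continuous fun c => halfSide c i := fun i => by
    unfold halfSide; fun_prop
  rw [continuousOn_pi]
  intro i
  have hm : ContinuousOn (fun c => midSide c i) {c | ∀ i, 1 ≤ c i} := by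
    unfold midSide
    refine ContinuousOn.div (by fun_prop)
      ((continuous_const.mul (hh _)).mul (hh _)).continuousOn fun c hc => ?_
    have h1 := one_le_halfSide hc (i + 1)
    have h2 := one_le_halfSide hc (i + 2)
    positivity
  cases L <;> fin_cases i <;> first | exact hm | exact (hh _).continuousOn

/-- Limits of the rescaled sides depend continuously on the triangle. -/
lemma continuous_limitSide {T : Type*} [TopologicalSpace T] {c : T → Fin 3 → ℝ}
    (hcont : Continuous c) (hc : ∀ t, IsSides (c t)) (s : ℕ → Letter) (i : Fin 3) :
    Continuous fun t => limitSide s (c t) i := by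
  have ho : ∀ n, Continuous fun t => sideOrbit s (c t) n := fun n => by
    induction n with
    | zero => exact hcont
    | succ n ih =>
      exact (continuousOn_sideStep (s n)).comp_continuous ih
        fun t => ((hc t).sideOrbit s n).one_le
  have hs : ∀ n, Continuous fun t => scaledSide s (c t) i n := fun n =>
    continuous_const.mul (((continuous_apply i).comp (ho n)).sub continuous_const)
  have hB : Continuous fun t => (c t i - 1) * size (c t) := by unfold size; fun_prop
  refine TendstoLocallyUniformly.continuous (F := fun n t => scaledSide s (c t) i n) (p := atTop)
    ?_ (Eventually.of_forall hs).frequently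
  rw [Metric.tendstoLocallyUniformly_iff]
  intro ε hε t
  -- The `+ 1` leaves room for the error constant of `dist_limitSide_le` to stay below `B` near `t`.
  set B := (c t i - 1) * size (c t) + 1
  refine ⟨{t' | (c t' i - 1) * size (c t') < B}, ?_, ?_⟩
  · exact hB.continuousAt.eventually (gt_mem_nhds (by linarith [show B = _ from rfl]))
  · have t4 : Tendsto (fun n : ℕ => B * ((1 : ℝ) / 4) ^ n) atTop (𝓝 (B * 0)) :=
      (tendsto_pow_atTop_nhds_zero_of_lt_one (by norm_num) (by norm_num)).const_mul B
    rw [mul_zero] at t4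
    filter_upwards [t4.eventually (gt_mem_nhds hε)] with n hn t' ht'
    refine (dist_limitSide_le (hc t') s i n).trans_lt (lt_of_le_of_lt ?_ hn)
    rw [one_div_pow, mul_one_div]
    have := Set.mem_ofPred.1 ht'
    gcongr

/-! ### The sides of a triangle -/

lemma halfSide_of_eq_cosh {c : Fin 3 → ℝ} {i : Fin 3} {d : ℝ} (h : c i = Real.cosh d) :
    halfSide c i = Real.cosh (d / 2) := by
  have h1 := two_add_two_cosh d
  have h2 : (1 + Real.cosh d) / 2 = (2 + 2 * Real.cosh d) / 2 ^ 2 := by ring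
  rw [halfSide, h, h2, Real.sqrt_div' _ (by positivity), h1, Real.sqrt_sq (by norm_num)]
  ring

/-- The midpoint formula applied twice. The numerator is symmetric in the three sides, so all
mid-lines share it. -/
lemma cosh_dist_hypMidpoint_hypMidpoint (z w u : ℍ) :
    Real.cosh (dist (hypMidpoint z w) (hypMidpoint z u)) =
      (1 + Real.cosh (dist z w) + Real.cosh (dist z u) + Real.cosh (dist w u)) /
        (4 * Real.cosh (dist z w / 2) * Real.cosh (dist z u / 2)) := by
  have h1 := Real.cosh_pos (dist z w / 2)
  have h2 := Real.cosh_pos (dist z u / 2)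
  have h3 := Real.cosh_two_mul (dist z u / 2)
  have h4 := Real.cosh_sq (dist z u / 2)
  rw [mul_div_cancel₀ _ (two_ne_zero)] at h3
  rw [cosh_dist_hypMidpoint, dist_comm z (hypMidpoint z u), dist_hypMidpoint_left,
    dist_comm w (hypMidpoint z u), cosh_dist_hypMidpoint, two_add_two_cosh, two_add_two_cosh,
    h3, dist_comm z w, dist_comm u w]
  field_simp
  linarith

/-- The hyperbolic cosines of the sides of a triangle, the `i`-th one facing the `i`-th vertex.
Euclidean triangles are regarded as infinitesimally small. -/
noncomputable def Triangle.sides : Triangle → Fin 3 → ℝ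
  | hyp v _ => fun i => Real.cosh (dist (v (i + 1)) (v (i + 2)))
  | euc _ _ => 1

lemma sideStep_one (L : Letter) : sideStep L 1 = 1 := by
  have h : ∀ i, halfSide 1 i = 1 := fun i => by norm_num [halfSide]
  have h' : ∀ i, midSide 1 i = 1 := fun i => by norm_num [midSide, h]
  funext i
  rcases sideStep_eq_or L 1 i with e | e <;> simp [e, h, h']

/-- Transfers the geometric subdivision to the recursion `sideStep`. Euclidean triangles fit in
because the constant 1 is fixed by every `sideStep L`. -/
lemma sides_sub (L : Letter) (t : Triangle) : (t.sub L).sides = sideStep L t.sides := by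
  rcases t with ⟨v, hv⟩ | ⟨v, hv⟩
  · have h0 : halfSide (Triangle.hyp v hv).sides 0 = Real.cosh (dist (v 1) (v 2) / 2) :=
      halfSide_of_eq_cosh rfl
    have h1 : halfSide (Triangle.hyp v hv).sides 1 = Real.cosh (dist (v 2) (v 0) / 2) :=
      halfSide_of_eq_cosh rfl
    have h2 : halfSide (Triangle.hyp v hv).sides 2 = Real.cosh (dist (v 0) (v 1) / 2) :=
      halfSide_of_eq_cosh rfl
    have m0 : midSide (Triangle.hyp v hv).sides 0 = Real.cosh
        (dist (hypMidpoint (v 0) (v 1)) (hypMidpoint (v 0) (v 2))) := by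
      rw [cosh_dist_hypMidpoint_hypMidpoint, midSide, zero_add, zero_add, h1, h2]
      simp only [Triangle.sides, Fin.isValue, zero_add, dist_comm (v 2) (v 0),
        show (1 : Fin 3) + 1 = 2 from rfl, show (1 : Fin 3) + 2 = 0 from rfl,
        show (2 : Fin 3) + 1 = 0 from rfl, show (2 : Fin 3) + 2 = 1 from rfl]
      ring
    have m1 : midSide (Triangle.hyp v hv).sides 1 = Real.cosh
        (dist (hypMidpoint (v 1) (v 2)) (hypMidpoint (v 0) (v 1))) := by
      rw [hypMidpoint_comm (v 0), cosh_dist_hypMidpoint_hypMidpoint, midSide,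
        show (1 : Fin 3) + 1 = 2 from rfl, show (1 : Fin 3) + 2 = 0 from rfl, h0, h2]
      simp only [Triangle.sides, Fin.isValue, zero_add, dist_comm (v 1) (v 0),
        show (1 : Fin 3) + 1 = 2 from rfl, show (1 : Fin 3) + 2 = 0 from rfl,
        show (2 : Fin 3) + 1 = 0 from rfl, show (2 : Fin 3) + 2 = 1 from rfl]
      ring
    have m2 : midSide (Triangle.hyp v hv).sides 2 = Real.cosh
        (dist (hypMidpoint (v 0) (v 2)) (hypMidpoint (v 1) (v 2))) := by
      rw [hypMidpoint_comm (v 0), hypMidpoint_comm (v 1), cosh_dist_hypMidpoint_hypMidpoint,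
        midSide, show (2 : Fin 3) + 1 = 0 from rfl, show (2 : Fin 3) + 2 = 1 from rfl, h0, h1]
      simp only [Triangle.sides, Fin.isValue, zero_add, dist_comm (v 2) (v 1),
        show (1 : Fin 3) + 1 = 2 from rfl, show (1 : Fin 3) + 2 = 0 from rfl,
        show (2 : Fin 3) + 1 = 0 from rfl, show (2 : Fin 3) + 2 = 1 from rfl]
      ring
    have dl : ∀ z w, dist z (hypMidpoint z w) = dist z w / 2 := fun z w => by
      rw [dist_comm, dist_hypMidpoint_left]
    have dr : ∀ z w, dist w (hypMidpoint z w) = dist z w / 2 := fun z w => by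
      rw [dist_comm, dist_hypMidpoint_right]
    have hs : ((Triangle.hyp v hv).sub L).sides = fun i => Real.cosh
        (dist (subVertices hypMidpoint v L (i + 1)) (subVertices hypMidpoint v L (i + 2))) := rfl
    rw [hs]
    generalize (Triangle.hyp v hv).sides = c at *
    funext i
    cases L <;> fin_cases i <;>
      simp [sideStep, h0, h1, h2, m0, m1, m2, subVertices, dist_hypMidpoint_left,
        dist_hypMidpoint_right, dl, dr, dist_comm (v 2) (v 0),
        dist_comm (hypMidpoint (v 0) (v 1)) (hypMidpoint (v 1) (v 2)),
        dist_comm (hypMidpoint (v 0) (v 2)) (hypMidpoint (v 0) (v 1)),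
        dist_comm (hypMidpoint (v 1) (v 2)) (hypMidpoint (v 0) (v 2))]
  · exact (sideStep_one L).symm

lemma sides_congr {s t : Triangle} (h : s ≈ t) : s.sides = t.sides := by
  rcases s with ⟨v, hv⟩ | ⟨v, hv⟩ <;> rcases t with ⟨w, hw⟩ | ⟨w, hw⟩
  · have h' : Congruent v w := h
    rw [congruent_iff_dist_eq] at h'
    funext i
    simp only [Triangle.sides, h']
  · exact False.elim h
  · exact False.elim h
  · rfl

lemma sideGram_sides_hyp (v : Fin 3 → ℍ) (hv : IsHypTriangle v) :
    0 < sideGram (Triangle.hyp v hv).sides := by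
  refine ((isHypTriangle_iff v).1 hv).trans_eq ?_
  simp only [gram, sideGram, Triangle.sides, zero_add, show (1 : Fin 3) + 1 = 2 from rfl,
    show (1 : Fin 3) + 2 = 0 from rfl, show (2 : Fin 3) + 1 = 0 from rfl,
    show (2 : Fin 3) + 2 = 1 from rfl, dist_comm (v 2) (v 0)]

lemma isSides_sides (t : Triangle) : IsSides t.sides := by
  rcases t with ⟨v, hv⟩ | ⟨v, hv⟩
  · exact ⟨fun i => Real.one_le_cosh _, (sideGram_sides_hyp v hv).le⟩
  · exact ⟨fun i => le_rfl, by norm_num [sideGram, Triangle.sides]⟩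

/-! ### The angles of a hyperbolic triangle in terms of its sides -/

/-- The hyperbolic law of cosines for the angles of a triangle with given hyperbolic cosines of
the sides. -/
noncomputable def sideAngle (c : Fin 3 → ℝ) (i : Fin 3) : ℝ :=
  Real.arccos ((c (i + 1) * c (i + 2) - c i) / (√(c (i + 1) ^ 2 - 1) * √(c (i + 2) ^ 2 - 1)))

lemma sqrt_cosh_sq_sub_one {d : ℝ} (hd : 0 ≤ d) : √(Real.cosh d ^ 2 - 1) = Real.sinh d := by
  rw [Real.cosh_sq, add_sub_cancel_right, Real.sqrt_sq (Real.sinh_nonneg_iff.2 hd)]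

lemma angles_hyp (v : Fin 3 → ℍ) (hv : IsHypTriangle v) :
    (Triangle.hyp v hv).angles = sideAngle (Triangle.hyp v hv).sides := by
  funext i
  simp only [Triangle.angles, Triangle.sides, sideAngle, hypAngle_eq_arccos,
    sqrt_cosh_sq_sub_one dist_nonneg]
  fin_cases i <;> simp [dist_comm (v 0) (v 1), dist_comm (v 2) (v 0), dist_comm (v 1) (v 2),
    mul_comm]

lemma sideGram_eq (c : Fin 3 → ℝ) (i : Fin 3) : sideGram c =
    1 + 2 * c i * c (i + 1) * c (i + 2) - c i ^ 2 - c (i + 1) ^ 2 - c (i + 2) ^ 2 := by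
  fin_cases i <;> simp [sideGram] <;> ring

/-- If `c i = 1`, the Gram determinant is minus the square of the difference of the two other
cosines. -/
lemma IsSides.one_lt {c : Fin 3 → ℝ} (hc : IsSides c) (hg : 0 < sideGram c) (i : Fin 3) :
    1 < c i := by
  refine lt_of_le_of_ne (hc.one_le i) fun h => ?_
  rw [sideGram_eq c i, ← h] at hg
  nlinarith [sq_nonneg (c (i + 1) - c (i + 2))]

section SideAngle

variable {c : Fin 3 → ℝ}

lemma one_sub_sq_lawOfCosines (hc : ∀ i, 1 < c i) (i : Fin 3) :
    1 - ((c (i + 1) * c (i + 2) - c i) / (√(c (i + 1) ^ 2 - 1) * √(c (i + 2) ^ 2 - 1))) ^ 2 =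
      sideGram c / ((c (i + 1) ^ 2 - 1) * (c (i + 2) ^ 2 - 1)) := by
  have h1 : 0 < c (i + 1) ^ 2 - 1 := by nlinarith [hc (i + 1)]
  have h2 : 0 < c (i + 2) ^ 2 - 1 := by nlinarith [hc (i + 2)]
  rw [div_pow, mul_pow, Real.sq_sqrt h1.le, Real.sq_sqrt h2.le, sideGram_eq c i]
  field_simp
  ring

lemma abs_lawOfCosines_lt_one (hc : ∀ i, 1 < c i) (hg : 0 < sideGram c) (i : Fin 3) :
    |(c (i + 1) * c (i + 2) - c i) / (√(c (i + 1) ^ 2 - 1) * √(c (i + 2) ^ 2 - 1))| < 1 := by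
  have h1 : 0 < c (i + 1) ^ 2 - 1 := by nlinarith [hc (i + 1)]
  have h2 : 0 < c (i + 2) ^ 2 - 1 := by nlinarith [hc (i + 2)]
  have h := one_sub_sq_lawOfCosines hc i
  have h3 : 0 < sideGram c / ((c (i + 1) ^ 2 - 1) * (c (i + 2) ^ 2 - 1)) := by positivity
  rw [← sq_lt_one_iff_abs_lt_one]
  linarith

lemma cos_sideAngle (hc : ∀ i, 1 < c i) (hg : 0 < sideGram c) (i : Fin 3) :
    Real.cos (sideAngle c i) =
      (c (i + 1) * c (i + 2) - c i) / (√(c (i + 1) ^ 2 - 1) * √(c (i + 2) ^ 2 - 1)) := by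
  have h := abs_lt.1 (abs_lawOfCosines_lt_one hc hg i)
  exact Real.cos_arccos h.1.le h.2.le

lemma sin_sideAngle (hc : ∀ i, 1 < c i) (i : Fin 3) :
    Real.sin (sideAngle c i) =
      √(sideGram c) / (√(c (i + 1) ^ 2 - 1) * √(c (i + 2) ^ 2 - 1)) := by
  have h1 : 0 < c (i + 1) ^ 2 - 1 := by nlinarith [hc (i + 1)]
  have h2 : 0 < c (i + 2) ^ 2 - 1 := by nlinarith [hc (i + 2)]
  rw [sideAngle, Real.sin_arccos, one_sub_sq_lawOfCosines hc, Real.sqrt_div' _ (by positivity),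
    Real.sqrt_mul h1.le]

lemma sideAngle_pos (hc : ∀ i, 1 < c i) (hg : 0 < sideGram c) (i : Fin 3) :
    0 < sideAngle c i :=
  Real.arccos_pos.2 (abs_lt.1 (abs_lawOfCosines_lt_one hc hg i)).2

lemma sin_sideAngle_pos (hc : ∀ i, 1 < c i) (hg : 0 < sideGram c) (i : Fin 3) :
    0 < Real.sin (sideAngle c i) := by
  have h1 : 0 < c (i + 1) ^ 2 - 1 := by nlinarith [hc (i + 1)]
  have h2 : 0 < c (i + 2) ^ 2 - 1 := by nlinarith [hc (i + 2)]
  rw [sin_sideAngle hc]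
  positivity

/-- The second hyperbolic law of cosines. -/
lemma side_mul_sin_mul_sin (hc : ∀ i, 1 < c i) (hg : 0 < sideGram c) (i : Fin 3) :
    c i * (Real.sin (sideAngle c (i + 1)) * Real.sin (sideAngle c (i + 2))) =
      Real.cos (sideAngle c i) +
        Real.cos (sideAngle c (i + 1)) * Real.cos (sideAngle c (i + 2)) := by
  have h0 : 0 < c i ^ 2 - 1 := by nlinarith [hc i]
  have h1 : 0 < c (i + 1) ^ 2 - 1 := by nlinarith [hc (i + 1)]
  have h2 : 0 < c (i + 2) ^ 2 - 1 := by nlinarith [hc (i + 2)]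
  have i1 : i + 1 + 1 = i + 2 := by fin_cases i <;> rfl
  have i2 : i + 1 + 2 = i := by fin_cases i <;> rfl
  have i3 : i + 2 + 1 = i := by fin_cases i <;> rfl
  have i4 : i + 2 + 2 = i + 1 := by fin_cases i <;> rfl
  simp only [cos_sideAngle hc hg, sin_sideAngle hc, i1, i2, i3, i4]
  have g := Real.sq_sqrt hg.le
  have s0 := Real.sq_sqrt h0.le
  have p0 := Real.sqrt_pos.2 h0
  have p1 := Real.sqrt_pos.2 h1
  have p2 := Real.sqrt_pos.2 h2
  field_simp
  rw [g, s0, sideGram_eq c i]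
  ring

/-- The second law of cosines with `c i` replaced by the smaller value 1, the sines being positive.
-/
lemma neg_cos_add_lt_cos (hc : ∀ i, 1 < c i) (hg : 0 < sideGram c) (i : Fin 3) :
    -Real.cos (sideAngle c (i + 1) + sideAngle c (i + 2)) < Real.cos (sideAngle c i) := by
  have h := side_mul_sin_mul_sin hc hg i
  have h1 := sin_sideAngle_pos hc hg (i + 1)
  have h2 := sin_sideAngle_pos hc hg (i + 2)
  rw [Real.cos_add]
  nlinarith [mul_pos (mul_pos h1 h2) (sub_pos.2 (hc i))]

/-- If the sum were at least π, `neg_cos_add_lt_cos` would force each angle below the sum of the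
other two minus π. Adding this for two of the angles makes the third exceed π. -/
lemma sum_sideAngle_lt_pi (hc : ∀ i, 1 < c i) (hg : 0 < sideGram c) :
    sideAngle c 0 + sideAngle c 1 + sideAngle c 2 < Real.pi := by
  by_contra! hle
  have hp : ∀ i, sideAngle c i ≤ Real.pi := fun i => Real.arccos_le_pi _
  have key : ∀ i, sideAngle c i + (sideAngle c (i + 1) + sideAngle c (i + 2)) ≥ Real.pi →
      sideAngle c i < sideAngle c (i + 1) + sideAngle c (i + 2) - Real.pi := fun i hi => by
    have h := neg_cos_add_lt_cos hc hg i
    have h0 := sideAngle_pos hc hg i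
    have h1 := hp (i + 1)
    have h2 := hp (i + 2)
    by_contra! hlt
    rcases le_total Real.pi (sideAngle c (i + 1) + sideAngle c (i + 2)) with hs | hs
    · have := Real.cos_le_cos_of_nonneg_of_le_pi (by linarith) (hp i) hlt
      rw [Real.cos_sub_pi] at this
      linarith
    · have := Real.cos_le_cos_of_nonneg_of_le_pi (by linarith) (hp i)
        (show Real.pi - (sideAngle c (i + 1) + sideAngle c (i + 2)) ≤ _ by linarith)
      rw [Real.cos_pi_sub] at this
      linarith
  have k0 := key 0 (by simp; linarith)
  have k1 := key 1 (by simp; linarith)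
  simp at k0 k1
  linarith [hp 2, sideAngle_pos hc hg 0, sideAngle_pos hc hg 1]

end SideAngle

/-! ### The angle coordinates -/

/-- Half the sum of the angles. -/
noncomputable def halfSum (θ : Fin 3 → ℝ) : ℝ := (θ 0 + θ 1 + θ 2) / 2

/-- A function of the angles that vanishes for Euclidean triangles. -/
noncomputable def scale (θ : Fin 3 → ℝ) : ℝ :=
  2 * Real.cos (halfSum θ) / (Real.sin (θ 0) * Real.sin (θ 1) * Real.sin (θ 2))

/-- The squares of the sides up to a factor, as functions of the angles. -/
noncomputable def shape (θ : Fin 3 → ℝ) (i : Fin 3) : ℝ :=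
  Real.sin (θ i) * Real.cos (halfSum θ - θ i)

/-- The set that parametrizes the moduli space. -/
structure IsAngles (θ : Fin 3 → ℝ) : Prop where
  pos : ∀ i, 0 < θ i
  sum_le : θ 0 + θ 1 + θ 2 ≤ Real.pi

section IsAngles

variable {θ : Fin 3 → ℝ}

lemma IsAngles.lt_pi (h : IsAngles θ) (i : Fin 3) : θ i < Real.pi := by
  have h0 := h.pos 0
  have h1 := h.pos 1
  have h2 := h.pos 2
  have h3 := h.sum_le
  fin_cases i <;> simp <;> linarith

lemma IsAngles.sin_pos (h : IsAngles θ) (i : Fin 3) : 0 < Real.sin (θ i) :=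
  Real.sin_pos_of_pos_of_lt_pi (h.pos i) (h.lt_pi i)

lemma IsAngles.shape_pos (h : IsAngles θ) (i : Fin 3) : 0 < shape θ i := by
  refine mul_pos (h.sin_pos i) (Real.cos_pos_of_mem_Ioo ⟨?_, ?_⟩)
  · have h0 := h.pos 0
    have h1 := h.pos 1
    have h2 := h.pos 2
    have hi := h.lt_pi i
    rw [halfSum]
    fin_cases i <;> simp at * <;> linarith
  · rw [halfSum]
    linarith [h.sum_le, h.pos i]

lemma IsAngles.scale_pos (h : IsAngles θ) (hs : θ 0 + θ 1 + θ 2 < Real.pi) : 0 < scale θ := by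
  have h0 := h.pos 0
  have h1 := h.pos 1
  have h2 := h.pos 2
  have := Real.cos_pos_of_mem_Ioo (x := halfSum θ)
    ⟨by rw [halfSum]; linarith, by rw [halfSum]; linarith⟩
  have s0 := h.sin_pos 0
  have s1 := h.sin_pos 1
  have s2 := h.sin_pos 2
  rw [scale]
  positivity

lemma scale_eq_zero (hs : θ 0 + θ 1 + θ 2 = Real.pi) : scale θ = 0 := by
  rw [scale, halfSum, hs, Real.cos_pi_div_two, mul_zero, zero_div]

/-- Sum-to-product turns the numerator into `2 * cos (halfSum θ) * cos (halfSum θ - θ i)`. The first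
cosine does not depend on `i`; putting `sin (θ i)` into `shape` makes the denominator independent of
`i` too. -/
lemma IsAngles.scale_mul_shape (h : IsAngles θ) (i : Fin 3) : scale θ * shape θ i =
    (Real.cos (θ i) + Real.cos (θ (i + 1) + θ (i + 2))) /
      (Real.sin (θ (i + 1)) * Real.sin (θ (i + 2))) := by
  have s0 := (h.sin_pos i).ne'
  have s1 := (h.sin_pos (i + 1)).ne'
  have s2 := (h.sin_pos (i + 2)).ne'
  have e1 : halfSum θ = (θ (i + 1) + θ (i + 2) + θ i) / 2 := by
    rw [halfSum]; fin_cases i <;> simp <;> ring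
  have e2 : halfSum θ - θ i = (θ (i + 1) + θ (i + 2) - θ i) / 2 := by rw [e1]; ring
  have e3 : Real.sin (θ 0) * Real.sin (θ 1) * Real.sin (θ 2) =
      Real.sin (θ i) * (Real.sin (θ (i + 1)) * Real.sin (θ (i + 2))) := by
    fin_cases i <;> simp <;> ring
  rw [add_comm (Real.cos (θ i)), Real.cos_add_cos, ← e1, ← e2, scale, shape, e3]
  field_simp

end IsAngles

lemma isAngles_sideAngle {c : Fin 3 → ℝ} (hc : ∀ i, 1 < c i) (hg : 0 < sideGram c) :
    IsAngles (sideAngle c) :=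
  ⟨sideAngle_pos hc hg, (sum_sideAngle_lt_pi hc hg).le⟩

lemma scale_mul_shape_sideAngle {c : Fin 3 → ℝ} (hc : ∀ i, 1 < c i) (hg : 0 < sideGram c)
    (i : Fin 3) : scale (sideAngle c) * shape (sideAngle c) i = c i - 1 := by
  have h1 := (sin_sideAngle_pos hc hg (i + 1)).ne'
  have h2 := (sin_sideAngle_pos hc hg (i + 2)).ne'
  rw [(isAngles_sideAngle hc hg).scale_mul_shape, Real.cos_add,
    div_eq_iff (mul_ne_zero h1 h2)]
  linear_combination -(side_mul_sin_mul_sin hc hg i)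

/-! ### Euclidean triangles -/

/-- The Euclidean law of cosines for the angles of a triangle with given squares of the sides. -/
noncomputable def eucAngle (V : Fin 3 → ℝ) (i : Fin 3) : ℝ :=
  Real.arccos ((V (i + 1) + V (i + 2) - V i) / (2 * (√(V (i + 1)) * √(V (i + 2)))))

lemma eucAngle_smul {k : ℝ} (hk : 0 < k) (V : Fin 3 → ℝ) :
    eucAngle (fun i => V i / k) = eucAngle V := by
  funext i
  have h := Real.sqrt_pos.2 hk
  have e : ∀ a b, 2 * (√(a / k) * √(b / k)) = 2 * (√a * √b) / k := fun a b => by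
    rw [Real.sqrt_div' _ hk.le, Real.sqrt_div' _ hk.le, div_mul_div_comm,
      Real.mul_self_sqrt hk.le, ← mul_div_assoc]
  simp only [eucAngle]
  rw [e, ← add_div, ← sub_div, div_div_div_cancel_right₀ hk.ne']

lemma angle_eq_arccos (p₁ p₂ p₃ : Plane) : EuclideanGeometry.angle p₁ p₂ p₃ =
    Real.arccos ((dist p₃ p₂ ^ 2 + dist p₂ p₁ ^ 2 - dist p₁ p₃ ^ 2) /
      (2 * (dist p₃ p₂ * dist p₂ p₁))) := by
  rw [EuclideanGeometry.angle, InnerProductGeometry.angle,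
    real_inner_eq_norm_mul_self_add_norm_mul_self_sub_norm_sub_mul_self_div_two,
    vsub_sub_vsub_cancel_right]
  simp only [← dist_eq_norm_vsub]
  rw [dist_comm p₂ p₁, div_div]
  congr 2 <;> ring

/-- There is a Euclidean triangle with given squares of the sides. -/
lemma exists_triangle_of_heron_pos {V : Fin 3 → ℝ} (hV : ∀ i, 0 < V i)
    (hh : 0 < 2 * (V 0 * V 1 + V 1 * V 2 + V 0 * V 2) - V 0 ^ 2 - V 1 ^ 2 - V 2 ^ 2) :
    ∃ (v : Fin 3 → Plane) (hv : AffineIndependent ℝ v),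
      (Triangle.euc v hv).angles = eucAngle V := by
  have h1 := hV 1
  have h2 := hV 2
  have hr := Real.sqrt_pos.2 h2
  have hr2 := Real.sq_sqrt h2.le
  set r := √(V 2)
  -- The third vertex is `(u, y)` over the base from `(0, 0)` to `(r, 0)`; its squared height is
  -- Heron's form over `4 * V 2`.
  set u := (V 1 + V 2 - V 0) / (2 * r) with hu
  have hH : V 1 - u ^ 2 = (2 * (V 0 * V 1 + V 1 * V 2 + V 0 * V 2) - V 0 ^ 2 - V 1 ^ 2 -
      V 2 ^ 2) / (4 * V 2) := by
    rw [hu, ← hr2]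
    field_simp
    ring
  have hpos : 0 < V 1 - u ^ 2 := by rw [hH]; positivity
  have hy := Real.sqrt_pos.2 hpos
  have hy2 := Real.sq_sqrt hpos.le
  set y := √(V 1 - u ^ 2)
  set v : Fin 3 → Plane := ![!₂[0, 0], !₂[r, 0], !₂[u, y]] with hvdef
  have hv : AffineIndependent ℝ v := by
    rw [affineIndependent_iff_linearIndependent_vsub ℝ _ (0 : Fin 3)]
    rw [← linearIndependent_equiv (finSuccAboveEquiv (0 : Fin 3)),
      show (fun i : {x : Fin 3 // x ≠ 0} => (v i -ᵥ v 0 : Plane)) ∘ finSuccAboveEquiv (0 : Fin 3) =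
        ![v 1 -ᵥ v 0, v 2 -ᵥ v 0] by funext k; fin_cases k <;> rfl, LinearIndependent.pair_iff]
    intro a b hab
    have e0 := congrArg (fun x : Plane => x 0) hab
    have e1 := congrArg (fun x : Plane => x 1) hab
    simp [hvdef] at e0 e1
    have hb : b = 0 := e1.resolve_right hy.ne'
    subst hb
    simp at e0
    exact ⟨e0.resolve_right hr.ne', rfl⟩
  have d2 : dist (v 0) (v 1) = √(V 2) := by
    rw [EuclideanSpace.dist_eq]
    simp [hvdef, Real.dist_eq, hr2]
  have d1 : dist (v 2) (v 0) = √(V 1) := by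
    rw [EuclideanSpace.dist_eq]
    simp [hvdef, Real.dist_eq, hy2]
  have d0 : dist (v 1) (v 2) = √(V 0) := by
    rw [EuclideanSpace.dist_eq]
    congr 1
    simp [hvdef, Real.dist_eq, hy2]
    rw [sub_sq, hr2, hu]
    field_simp
    ring
  refine ⟨v, hv, ?_⟩
  have q0 := Real.sq_sqrt (hV 0).le
  have q1 := Real.sq_sqrt (hV 1).le
  have q2 := Real.sq_sqrt (hV 2).le
  funext i
  simp only [Triangle.angles, eucAngle, angle_eq_arccos]
  fin_cases i <;> simp [d0, d1, d2, q0, q1, q2]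

lemma not_collinear_of_affineIndependent {v : Fin 3 → Plane} (hv : AffineIndependent ℝ v)
    (i : Fin 3) : ¬ Collinear ℝ {v (i + 1), v i, v (i + 2)} := by
  rw [← affineIndependent_iff_not_collinear_set]
  have e : ![v (i + 1), v i, v (i + 2)] = v ∘ ![i + 1, i, i + 2] := by
    funext k; fin_cases k <;> rfl
  rw [e]
  refine hv.comp_embedding ⟨![i + 1, i, i + 2], ?_⟩
  fin_cases i <;> decide

lemma isAngles_euc (v : Fin 3 → Plane) (hv : AffineIndependent ℝ v) :
    IsAngles (Triangle.euc v hv).angles ∧ (Triangle.euc v hv).angles 0 +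
      (Triangle.euc v hv).angles 1 + (Triangle.euc v hv).angles 2 = Real.pi := by
  have hsum : (Triangle.euc v hv).angles 0 + (Triangle.euc v hv).angles 1 +
      (Triangle.euc v hv).angles 2 = Real.pi := by
    have h10 : v 1 ≠ v 0 := hv.injective.ne (by decide)
    have := EuclideanGeometry.angle_add_angle_add_angle_eq_pi (v 2) h10
    simp only [Triangle.angles, zero_add, show (1 : Fin 3) + 1 = 2 from rfl,
      show (1 : Fin 3) + 2 = 0 from rfl, show (2 : Fin 3) + 1 = 0 from rfl,
      show (2 : Fin 3) + 2 = 1 from rfl]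
    linarith [EuclideanGeometry.angle_comm (v 0) (v 1) (v 2),
      EuclideanGeometry.angle_comm (v 2) (v 0) (v 1),
      EuclideanGeometry.angle_comm (v 1) (v 2) (v 0)]
  exact ⟨⟨fun i => EuclideanGeometry.angle_pos_of_not_collinear
    (not_collinear_of_affineIndependent hv i), hsum.le⟩, hsum⟩

/-- For angle sum π, `halfSum θ = π / 2` and `shape θ i = sin (θ i) ^ 2`, so this is the law of
sines: squared sides are proportional to squared sines. -/
lemma eucAngle_shape {θ : Fin 3 → ℝ} (h : IsAngles θ) (hs : θ 0 + θ 1 + θ 2 = Real.pi) :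
    eucAngle (shape θ) = θ := by
  have e : ∀ j, shape θ j = Real.sin (θ j) ^ 2 := fun j => by
    rw [shape, halfSum, hs, Real.cos_pi_div_two_sub, sq]
  funext i
  have e0 : θ i = Real.pi - (θ (i + 1) + θ (i + 2)) := by
    fin_cases i <;> simp <;> linarith
  have h1 := h.sin_pos (i + 1)
  have h2 := h.sin_pos (i + 2)
  have hc : (shape θ (i + 1) + shape θ (i + 2) - shape θ i) /
      (2 * (√(shape θ (i + 1)) * √(shape θ (i + 2)))) = Real.cos (θ i) := by
    rw [e, e, e, Real.sqrt_sq h1.le, Real.sqrt_sq h2.le, e0, Real.cos_pi_sub, Real.sin_pi_sub,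
      Real.cos_add, Real.sin_add, div_eq_iff (by positivity)]
    have q1 := Real.sin_sq_add_cos_sq (θ (i + 1))
    have q2 := Real.sin_sq_add_cos_sq (θ (i + 2))
    linear_combination -(Real.sin (θ (i + 1)) ^ 2) * q2 - Real.sin (θ (i + 2)) ^ 2 * q1
  rw [eucAngle, hc, Real.arccos_cos (h.pos i).le (h.lt_pi i).le]

namespace Moduli

/-! ### The limit map -/

/-- The hyperbolic cosines of the sides as functions on the moduli space. -/
noncomputable def sides : Moduli → Fin 3 → ℝ :=
  Quotient.lift Triangle.sides fun _ _ => sides_congr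

lemma isSides_sides (Δ : Moduli) : IsSides (sides Δ) := by
  induction Δ using Quotient.ind with
  | _ t => exact TriangleIFS.isSides_sides t

lemma sides_f (L : Letter) (Δ : Moduli) : sides (f L Δ) = sideStep L (sides Δ) := by
  induction Δ using Quotient.ind with
  | _ t => exact sides_sub L t

lemma sides_orbit (s : ℕ → Letter) (Δ : Moduli) (n : ℕ) :
    sides (orbit s Δ n) = sideOrbit s (sides Δ) n := by
  induction n with
  | zero => rfl
  | succ n ih => rw [orbit, sides_f, ih, sideOrbit]

lemma mem_euclidean_or_sideGram_pos (Δ : Moduli) :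
    Δ ∈ euclidean ∨ 0 < sideGram (sides Δ) := by
  induction Δ using Quotient.ind with
  | _ t =>
    rcases t with ⟨v, hv⟩ | ⟨v, hv⟩
    · exact Or.inr (sideGram_sides_hyp v hv)
    · exact Or.inl ⟨v, hv, rfl⟩

lemma angles_eq_sideAngle {Δ : Moduli} (h : 0 < sideGram (sides Δ)) :
    angles Δ = sideAngle (sides Δ) := by
  induction Δ using Quotient.ind with
  | _ t =>
    rcases t with ⟨v, hv⟩ | ⟨v, hv⟩
    · exact angles_hyp v hv
    · change 0 < sideGram 1 at h
      norm_num [sideGram] at h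

lemma sum_angles_of_mem_euclidean {Δ : Moduli} (h : Δ ∈ euclidean) :
    angles Δ 0 + angles Δ 1 + angles Δ 2 = Real.pi := by
  obtain ⟨v, hv, rfl⟩ := h
  exact (isAngles_euc v hv).2

lemma sides_of_mem_euclidean {Δ : Moduli} (h : Δ ∈ euclidean) : sides Δ = 1 := by
  obtain ⟨v, hv, rfl⟩ := h
  rfl

lemma f_of_mem_euclidean {Δ : Moduli} (h : Δ ∈ euclidean) (L : Letter) : f L Δ = Δ := by
  obtain ⟨v, hv, rfl⟩ := h
  exact Quotient.sound (subVertices_similar v L)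

lemma orbit_of_mem_euclidean {Δ : Moduli} (h : Δ ∈ euclidean) (s : ℕ → Letter) (n : ℕ) :
    orbit s Δ n = Δ := by
  induction n with
  | zero => rfl
  | succ n ih => rw [orbit, ih, f_of_mem_euclidean h]

lemma isAngles_angles (Δ : Moduli) : IsAngles (angles Δ) := by
  rcases mem_euclidean_or_sideGram_pos Δ with h | h
  · obtain ⟨v, hv, rfl⟩ := h
    exact (isAngles_euc v hv).1
  · rw [angles_eq_sideAngle h]
    exact isAngles_sideAngle ((isSides_sides Δ).one_lt h) h

lemma scale_angles_of_mem_euclidean {Δ : Moduli} (h : Δ ∈ euclidean) : scale (angles Δ) = 0 :=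
  scale_eq_zero (sum_angles_of_mem_euclidean h)

lemma scale_angles_pos {Δ : Moduli} (h : 0 < sideGram (sides Δ)) : 0 < scale (angles Δ) := by
  refine (isAngles_angles Δ).scale_pos ?_
  rw [angles_eq_sideAngle h]
  exact sum_sideAngle_lt_pi ((isSides_sides Δ).one_lt h) h

/-- One formula valid on both sides of the Euclidean boundary, where `scale` vanishes; it makes the
sides continuous in the angle topology. -/
lemma sides_sub_one (Δ : Moduli) (i : Fin 3) :
    sides Δ i - 1 = scale (angles Δ) * shape (angles Δ) i := by
  rcases mem_euclidean_or_sideGram_pos Δ with h | h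
  · rw [scale_angles_of_mem_euclidean h, sides_of_mem_euclidean h, zero_mul, Pi.one_apply, sub_self]
  · rw [angles_eq_sideAngle h, scale_mul_shape_sideAngle ((isSides_sides Δ).one_lt h) h]

/-! ### Continuity in the angle coordinates. -/

lemma continuous_angles : Continuous angles := continuous_induced_dom

lemma continuous_angles_apply (i : Fin 3) : Continuous fun Δ => angles Δ i :=
  (continuous_apply i).comp continuous_angles

lemma continuous_halfSum_angles : Continuous fun Δ => halfSum (angles Δ) :=
  (((continuous_angles_apply 0).add (continuous_angles_apply 1)).add
    (continuous_angles_apply 2)).div_const 2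

lemma continuous_scale_angles : Continuous fun Δ => scale (angles Δ) := by
  have h := fun i => Real.continuous_sin.comp (continuous_angles_apply i)
  refine (continuous_const.mul (Real.continuous_cos.comp continuous_halfSum_angles)).div
    (((h 0).mul (h 1)).mul (h 2)) fun Δ => ?_
  have := (isAngles_angles Δ).sin_pos
  exact (mul_pos (mul_pos (this 0) (this 1)) (this 2)).ne'

lemma continuous_shape_angles (i : Fin 3) : Continuous fun Δ => shape (angles Δ) i :=
  (Real.continuous_sin.comp (continuous_angles_apply i)).mul
    (Real.continuous_cos.comp (continuous_halfSum_angles.sub (continuous_angles_apply i)))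

lemma continuous_sides : Continuous sides := by
  refine continuous_pi fun i => ?_
  have e : (fun Δ => sides Δ i) = fun Δ => scale (angles Δ) * shape (angles Δ) i + 1 := by
    funext Δ
    rw [← sides_sub_one, sub_add_cancel]
  rw [e]
  exact (continuous_scale_angles.mul (continuous_shape_angles i)).add continuous_const

open Classical in
/-- The squares of the sides of the limit triangle, normalized so that they extend continuously to
Euclidean triangles. -/
noncomputable def limitShape (s : ℕ → Letter) (Δ : Moduli) (i : Fin 3) : ℝ :=
  if scale (angles Δ) = 0 then shape (angles Δ) i
  else limitSide s (sides Δ) i / scale (angles Δ)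

lemma limitShape_of_mem_euclidean {Δ : Moduli} (h : Δ ∈ euclidean) (s : ℕ → Letter) :
    limitShape s Δ = shape (angles Δ) := by
  funext i
  rw [limitShape, if_pos (scale_angles_of_mem_euclidean h)]

lemma limitShape_of_sideGram_pos {Δ : Moduli} (h : 0 < sideGram (sides Δ)) (s : ℕ → Letter) :
    limitShape s Δ = fun i => limitSide s (sides Δ) i / scale (angles Δ) := by
  funext i
  rw [limitShape, if_neg (scale_angles_pos h).ne']

lemma limitShape_le (s : ℕ → Letter) (Δ : Moduli) (i : Fin 3) :
    limitShape s Δ i ≤ shape (angles Δ) i := by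
  rcases mem_euclidean_or_sideGram_pos Δ with h | h
  · rw [limitShape_of_mem_euclidean h]
  · rw [limitShape_of_sideGram_pos h, div_le_iff₀' (scale_angles_pos h), ← sides_sub_one]
    exact limitSide_le_sub_one (isSides_sides Δ) s i

/-- The lower bound for `limitSide` divided by `scale`. With `limitShape_le` it squeezes
`limitShape` near Euclidean triangles, where `size` tends to 0. -/
lemma le_limitShape (s : ℕ → Letter) (Δ : Moduli) (i : Fin 3) :
    shape (angles Δ) i * Real.exp (-(size (sides Δ) / 3)) ≤ limitShape s Δ i := by
  rcases mem_euclidean_or_sideGram_pos Δ with h | h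
  · rw [limitShape_of_mem_euclidean h, sides_of_mem_euclidean h]
    simp [size]
  · rw [limitShape_of_sideGram_pos h, le_div_iff₀' (scale_angles_pos h), ← mul_assoc,
      ← sides_sub_one]
    exact sub_one_mul_exp_le_limitSide (isSides_sides Δ) s i

lemma limitShape_pos (s : ℕ → Letter) (Δ : Moduli) (i : Fin 3) : 0 < limitShape s Δ i :=
  (mul_pos ((isAngles_angles Δ).shape_pos i) (Real.exp_pos _)).trans_le (le_limitShape s Δ i)

lemma continuous_limitShape (s : ℕ → Letter) (i : Fin 3) :
    Continuous fun Δ => limitShape s Δ i := by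
  rw [continuous_iff_continuousAt]
  intro Δ
  rcases mem_euclidean_or_sideGram_pos Δ with h | h
  · have hsize : Continuous fun Δ => size (sides Δ) := by
      have hs := fun i => (continuous_apply i).comp continuous_sides
      exact (((hs 0).sub continuous_const).add ((hs 1).sub continuous_const)).add
        ((hs 2).sub continuous_const)
    have hl : Continuous fun Δ => shape (angles Δ) i * Real.exp (-(size (sides Δ) / 3)) :=
      (continuous_shape_angles i).mul (Real.continuous_exp.comp (hsize.div_const 3).neg)
    have h1 := hl.tendsto Δ
    have h2 := (continuous_shape_angles i).tendsto Δ
    have e1 : shape (angles Δ) i * Real.exp (-(size (sides Δ) / 3)) = shape (angles Δ) i := by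
      rw [sides_of_mem_euclidean h]
      simp [size]
    rw [e1] at h1
    rw [ContinuousAt, limitShape_of_mem_euclidean h]
    exact tendsto_of_tendsto_of_tendsto_of_le_of_le h1 h2 (fun Δ => le_limitShape s Δ i)
      fun Δ => limitShape_le s Δ i
  · have hc : ContinuousAt (fun Δ => limitSide s (sides Δ) i / scale (angles Δ)) Δ :=
      (continuous_limitSide continuous_sides isSides_sides s i).continuousAt.div
        continuous_scale_angles.continuousAt (scale_angles_pos h).ne'
    -- By continuity `scale` stays positive nearby, so the quotient branch of `limitShape` applies
    -- on a neighbourhood.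
    refine hc.congr ?_
    filter_upwards [continuous_scale_angles.continuousAt.eventually
      (lt_mem_nhds (scale_angles_pos h))] with Δ' h'
    rw [limitShape, if_neg h'.ne']

lemma continuous_eucAngle_limitShape (s : ℕ → Letter) :
    Continuous fun Δ => eucAngle (limitShape s Δ) := by
  refine continuous_pi fun i => Real.continuous_arccos.comp ?_
  have h := continuous_limitShape s
  refine (((h (i + 1)).add (h (i + 2))).sub (h i)).div
    (continuous_const.mul ((Real.continuous_sqrt.comp (h (i + 1))).mul
      (Real.continuous_sqrt.comp (h (i + 2))))) fun Δ => ?_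
  have h1 := Real.sqrt_pos.2 (limitShape_pos s Δ (i + 1))
  have h2 := Real.sqrt_pos.2 (limitShape_pos s Δ (i + 2))
  exact (mul_pos two_pos (mul_pos h1 h2)).ne'

/-! ### The limit triangle and convergence of the angles. -/

lemma limitSide_pos {Δ : Moduli} (h : 0 < sideGram (sides Δ)) (s : ℕ → Letter) (i : Fin 3) :
    0 < limitSide s (sides Δ) i :=
  (mul_pos (sub_pos.2 ((isSides_sides Δ).one_lt h i)) (Real.exp_pos _)).trans_le
    (sub_one_mul_exp_le_limitSide (isSides_sides Δ) s i)

lemma exists_euclidean_angles_eq (s : ℕ → Letter) (Δ : Moduli) :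
    ∃ Ψ ∈ euclidean, angles Ψ = eucAngle (limitShape s Δ) := by
  rcases mem_euclidean_or_sideGram_pos Δ with h | h
  · refine ⟨Δ, h, ?_⟩
    rw [limitShape_of_mem_euclidean h,
      eucAngle_shape (isAngles_angles Δ) (sum_angles_of_mem_euclidean h)]
  · obtain ⟨v, hv, e⟩ := exists_triangle_of_heron_pos (limitSide_pos h s)
      (heron_limitSide_pos (isSides_sides Δ) h s)
    refine ⟨Quotient.mk _ (.euc v hv), ⟨v, hv, rfl⟩, ?_⟩
    rw [limitShape_of_sideGram_pos h, eucAngle_smul (scale_angles_pos h)]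
    exact e

/-- Distributes the rescaling `k = 4 ^ n` over the denominators of the law of cosines, using `x ^ 2
- 1 = (x - 1) * (x + 1)`. -/
lemma sqrt_sq_sub_one_mul {k x : ℝ} (hk : 0 ≤ k) (hx : 1 ≤ x) :
    √(x ^ 2 - 1) * √k = √(k * (x - 1)) * √(x + 1) := by
  rw [← Real.sqrt_mul (by nlinarith), ← Real.sqrt_mul (mul_nonneg hk (by linarith))]
  ring_nf

/-- The angles of the triangles of an orbit tend to those of the limit triangle. -/
lemma tendsto_sideAngle_sideOrbit {c : Fin 3 → ℝ} (hc : IsSides c) (s : ℕ → Letter)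
    (hpos : ∀ i, 0 < limitSide s c i) :
    Tendsto (fun n => sideAngle (sideOrbit s c n)) atTop (𝓝 (eucAngle (limitSide s c))) := by
  rw [tendsto_pi_nhds]
  intro i
  refine (Real.continuous_arccos.tendsto _).comp ?_
  have t := tendsto_scaledSide hc s
  have t4 : Tendsto (fun n : ℕ => ((1 : ℝ) / 4) ^ n) atTop (𝓝 0) :=
    tendsto_pow_atTop_nhds_zero_of_lt_one (by norm_num) (by norm_num)
  have tx : ∀ j, Tendsto (fun n => sideOrbit s c n j) atTop (𝓝 1) := fun j => by
    have h := (t4.mul (t j)).add_const 1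
    rw [zero_mul, zero_add] at h
    refine h.congr fun n => ?_
    rw [scaledSide, one_div_pow]
    field_simp
    ring
  have tr : ∀ j, Tendsto (fun n => √(scaledSide s c j n) * √(sideOrbit s c n j + 1)) atTop
      (𝓝 (√(limitSide s c j) * √(1 + 1))) := fun j =>
    ((t j).sqrt).mul ((tx j).add_const 1).sqrt
  have hne : √(limitSide s c (i + 1)) * √(1 + 1) * (√(limitSide s c (i + 2)) * √(1 + 1)) ≠ 0 := by
    have h1 := Real.sqrt_pos.2 (hpos (i + 1))
    have h2 := Real.sqrt_pos.2 (hpos (i + 2))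
    positivity
  -- Numerator and denominator of the law of cosines are multiplied by `4 ^ n`, with `y * z - x = (y
  -- - 1) * z + (z - 1) - (x - 1)`. Since the cosines tend to 1, the Euclidean law of cosines
  -- remains.
  have T := (((((t (i + 1)).mul (tx (i + 2))).add (t (i + 2))).sub (t i))).div
    ((tr (i + 1)).mul (tr (i + 2))) hne
  have e2 : √(1 + 1 : ℝ) * √(1 + 1) = 2 := by rw [Real.mul_self_sqrt] <;> norm_num
  have e3 : √(limitSide s c (i + 1)) * √(1 + 1) * (√(limitSide s c (i + 2)) * √(1 + 1)) =
      2 * (√(limitSide s c (i + 1)) * √(limitSide s c (i + 2))) := by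
    rw [mul_mul_mul_comm, e2, mul_comm]
  rw [mul_one, e3] at T
  refine T.congr fun n => ?_
  have h4 : (0 : ℝ) < 4 ^ n := by positivity
  have o := (hc.sideOrbit s n).one_le
  simp only [Pi.div_apply, scaledSide]
  rw [← sqrt_sq_sub_one_mul h4.le (o _), ← sqrt_sq_sub_one_mul h4.le (o _), mul_mul_mul_comm,
    Real.mul_self_sqrt h4.le, ← mul_div_mul_right (_ - _) (√_ * √_) h4.ne']
  congr 1
  ring

lemma tendsto_angles_orbit (s : ℕ → Letter) (Δ : Moduli) :
    Tendsto (fun n => angles (orbit s Δ n)) atTop (𝓝 (eucAngle (limitShape s Δ))) := by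
  rcases mem_euclidean_or_sideGram_pos Δ with h | h
  · simp only [orbit_of_mem_euclidean h]
    rw [limitShape_of_mem_euclidean h,
      eucAngle_shape (isAngles_angles Δ) (sum_angles_of_mem_euclidean h)]
    exact tendsto_const_nhds
  · have hg : ∀ n, 0 < sideGram (sides (orbit s Δ n)) := fun n => by
      rw [sides_orbit]
      -- The uniform lower bound keeps every triangle of the orbit on the hyperbolic side, so its
      -- angles are given by the law of cosines.
      have h1 := (mul_pos h (Real.exp_pos _)).trans_le (le_scaledGram (isSides_sides Δ) s n)
      exact pos_of_mul_pos_right h1 (by positivity)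
    rw [limitShape_of_sideGram_pos h, eucAngle_smul (scale_angles_pos h)]
    refine (tendsto_sideAngle_sideOrbit (isSides_sides Δ) s (limitSide_pos h s)).congr fun n => ?_
    rw [angles_eq_sideAngle (hg n), sides_orbit]

end Moduli

end TriangleIFS

theorem theorem1 (s : ℕ → TriangleIFS.Letter) :
    ∃ Φ : TriangleIFS.Moduli → TriangleIFS.Moduli,
      (∀ Δ, Φ Δ ∈ TriangleIFS.Moduli.euclidean ∧
        Tendsto (fun n => TriangleIFS.Moduli.orbit s Δ n) atTop (𝓝 (Φ Δ))) ∧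
      Continuous Φ := by
  -- The topology is induced by `angles`, so convergence and continuity only involve the prescribed
  -- angles of `Φ Δ`; no choice of representative matters.
  choose Φ hΦ hangles using TriangleIFS.Moduli.exists_euclidean_angles_eq s
  refine ⟨Φ, fun Δ => ⟨hΦ Δ, ?_⟩, ?_⟩
  · rw [nhds_induced, tendsto_comap_iff, hangles]
    exact TriangleIFS.Moduli.tendsto_angles_orbit s Δ
  · rw [continuous_induced_rng]
    exact (TriangleIFS.Moduli.continuous_eucAngle_limitShape s).congr fun Δ => (hangles Δ).symm
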